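/- All Hilbert spaces are finite-dimensional, with $|A_1|,|A_2|\ge 2$; $\log$ is to base $2$, and $\|M\|_p=(\operatorname{Tr}(M^\dagger M)^{p/2})^{1/p}$. A subnormalised density matrix is a positive semidefinite matrix of trace at most one. For positive semidefinite $\alpha,\beta$ put $D_2(\alpha\|\beta)=2\log\|\beta^{-1/4}\alpha\beta^{-1/4}\|_2$ if $\operatorname{supp}\alpha\subseteq\operatorname{supp}\beta$ (powers of the Moore–Penrose pseudoinverse, $\log 0=-\infty$) and $D_2(\alpha\|\beta)=+\infty$ otherwise. Let $D_2^\epsilon(\alpha\|\beta)=\min_{\alpha'}D_2(\alpha'\|\beta)$ over all subnormalised density matrices $\alpha'$ with $\|\alpha'-\alpha\|_1\le\epsilon\operatorname{Tr}\alpha$, and let $H_2^\epsilon(X|Y)_\omega=-D_2^\epsilon(\omega^{XY}\|\mathbb 1^X\otimes\omega^Y)$, where superscripts on a state denote its marginals and $2^{-\infty}=0$. Let $\mathcal T^{A_1A_2\to B}$ be a completely positive trace non-increasing superoperator, and let $$\tau^{A_1'A_2'B}=(\mathcal T\otimes\mathbb I^{A_1'A_2'})(\Phi^{A_1'A_1}\otimes\Phi^{A_2'A_2}),\qquad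 \Phi^{A'A}=|A|^{-1}\sum_{a,b=1}^{|A|}|a,a\rangle\langle b,b|,$$ be its Choi state, where $A_i'$ has the same dimension as $A_i$. Let $\rho^{A_1A_2R}$ be a subnormalised density matrix, and for unitaries $U_1$ on $A_1$ and $U_2$ on $A_2$ let $$\sigma^{BR}(U_1,U_2)=(\mathcal T\otimes\mathbb I^R)\big((U_1\otimes U_2\otimes\mathbb 1^R)\,\rho\,(U_1\otimes U_2\otimes\mathbb 1^R)^\dagger\big).$$ Put $D_i=(1-|A_i|^{-2})^{-1/2}$ for $i=1,2$ and $D_{1,2}=2D_1D_2$. Then for every $0<\epsilon<1$, $$\mathbb E_{U_1,U_2}\big\|\sigma^{BR}(U_1,U_2)-\tau^B\otimes\rho^R\big\|_1\le 16\epsilon+2D_1\,2^{-\frac12H_2^\epsilon(A_1|R)_\rho-\frac12H_2^\epsilon(A_1'|B)_\tau}+2D_2\,2^{-\frac12H_2^\epsilon(A_2|R)_\rho-\frac12H_2^\epsilon(A_2'|B)_\tau}+4D_{1,2}\,2^{-\frac12H_2^\epsilon(A_1A_2|R)_\rho-\frac12H_2^\epsilon(A_1'A_2'|B)_\tau},$$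 where $U_1$ and $U_2$ are independent and distributed according to the Haar probability measures on their unitary groups. -/

import Mathlib

open scoped Kronecker ENNReal Matrix ComplexOrder

noncomputable section

namespace Decoupling

/-! A finite-dimensional Hilbert space with a fixed orthonormal basis is represented by the finite
index type of that basis, operators on it by complex square matrices, and the tensor product of
two spaces by the product of the index types. -/

/-! ### Schatten norms, supports and Rényi-2 divergences -/

section Entropy

variable {n : Type*} [Fintype n] [DecidableEq n]

/-- The Schatten `p`-norm `(Tr (M† M)^(p/2))^(1/p)`. -/
def schattenNorm (p : ℝ) (M : Matrix n n ℂ) : ℝ :=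
  ((cfc (fun x : ℝ => x ^ (p / 2)) (Mᴴ * M)).trace.re) ^ (1 / p)

/-- `β^(-1/4)` for a positive semidefinite matrix `β`, in the sense of the Moore-Penrose
pseudoinverse: the eigenvalue `0` is sent to `0`. -/
def invFourthRoot (β : Matrix n n ℂ) : Matrix n n ℂ :=
  cfc (fun x : ℝ => if x = 0 then 0 else x ^ (-(1 / 4) : ℝ)) β

/-- The support of a Hermitian matrix: the span of the eigenvectors with non-zero eigenvalue,
that is, its range. -/
def support (M : Matrix n n ℂ) : Submodule ℂ (n → ℂ) :=
  LinearMap.range M.mulVecLin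

/-- Positive semidefinite with trace at most one. -/
def IsSubnormalised (α : Matrix n n ℂ) : Prop :=
  α.PosSemidef ∧ α.trace.re ≤ 1

/-- Binary logarithm on `[0, ∞]`, with `log 0 = -∞` and `log ∞ = ∞`. -/
def log2 (x : ℝ≥0∞) : EReal :=
  ENNReal.log x / (Real.log 2 : ℝ)

/-- `2 ^ x` for an extended real `x`, with `2 ^ (-∞) = 0` and `2 ^ ∞ = ∞`. -/
def pow2 (x : EReal) : ℝ≥0∞ :=
  EReal.exp (x * (Real.log 2 : ℝ))

open Classical in
/-- The Rényi-2 divergence `2 log ‖β^(-1/4) α β^(-1/4)‖₂` when `supp α ≤ supp β`, and `∞`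
otherwise. -/
def renyiTwoDiv (α β : Matrix n n ℂ) : EReal :=
  if support α ≤ support β then
    2 * log2 (ENNReal.ofReal (schattenNorm 2 (invFourthRoot β * α * invFourthRoot β)))
  else ⊤

/-- The smooth Rényi-2 divergence: the least `D₂(α' ‖ β)` over the subnormalised density matrices
`α'` with `‖α' - α‖₁ ≤ ε Tr α`. -/
def smoothRenyiTwoDiv (ε : ℝ) (α β : Matrix n n ℂ) : EReal :=
  ⨅ α' : {α' : Matrix n n ℂ //
      IsSubnormalised α' ∧ schattenNorm 1 (α' - α) ≤ ε * α.trace.re},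
    renyiTwoDiv α'.1 β

end Entropy

/-! ### Partial traces and the smooth conditional entropy -/

section Bipartite

variable {X Y Z : Type*}

/-- The marginal on `Y` of an operator on `X ⊗ Y`. -/
def traceLeft [Fintype X] (M : Matrix (X × Y) (X × Y) ℂ) : Matrix Y Y ℂ :=
  Matrix.of fun y y' => ∑ x, M (x, y) (x, y')

/-- The marginal on `X ⊗ Z` of an operator on `(X ⊗ Y) ⊗ Z`. -/
def marginalFst [Fintype Y] (M : Matrix ((X × Y) × Z) ((X × Y) × Z) ℂ) :
    Matrix (X × Z) (X × Z) ℂ :=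
  Matrix.of fun p q => ∑ y, M ((p.1, y), p.2) ((q.1, y), q.2)

/-- The marginal on `Y ⊗ Z` of an operator on `(X ⊗ Y) ⊗ Z`. -/
def marginalSnd [Fintype X] (M : Matrix ((X × Y) × Z) ((X × Y) × Z) ℂ) :
    Matrix (Y × Z) (Y × Z) ℂ :=
  Matrix.of fun p q => ∑ x, M ((x, p.1), p.2) ((x, q.1), q.2)

/-- The smooth conditional Rényi-2 entropy `H₂^ε(X|Y)_ω = - D₂^ε(ω^{XY} ‖ 1^X ⊗ ω^Y)`. -/
def smoothCondEntropy [Fintype X] [DecidableEq X] [Fintype Y] [DecidableEq Y]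
    (ε : ℝ) (ω : Matrix (X × Y) (X × Y) ℂ) : EReal :=
  -smoothRenyiTwoDiv ε ω ((1 : Matrix X X ℂ) ⊗ₖ traceLeft ω)

end Bipartite

/-! ### Superoperators and the Choi state -/

section Superoperator

variable {A B : Type*}

/-- The superoperator `T ⊗ 𝕀^R`, which applies `T` to every `R`-block. -/
def ampliate (R : Type*) (T : Matrix A A ℂ →ₗ[ℂ] Matrix B B ℂ) (M : Matrix (A × R) (A × R) ℂ) :
    Matrix (B × R) (B × R) ℂ :=
  Matrix.of fun p q => T (Matrix.of fun a a' => M (a, p.2) (a', q.2)) p.1 q.1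

/-- `T` is completely positive: `T ⊗ 𝕀` preserves positive semidefiniteness for every
finite-dimensional ancilla. -/
def IsCompletelyPositive (T : Matrix A A ℂ →ₗ[ℂ] Matrix B B ℂ) : Prop :=
  ∀ (k : ℕ) (M : Matrix (A × Fin k) (A × Fin k) ℂ), M.PosSemidef → (ampliate (Fin k) T M).PosSemidef

/-- `T` does not increase the trace of positive semidefinite operators. -/
def IsTraceNonincreasing [Fintype A] [Fintype B] (T : Matrix A A ℂ →ₗ[ℂ] Matrix B B ℂ) : Prop :=
  ∀ M : Matrix A A ℂ, M.PosSemidef → (T M).trace.re ≤ M.trace.re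

/-- The EPR state `|A|⁻¹ ∑ |a₁ a₁⟩⟨a₂ a₂|` on two copies of `A`. -/
def epr (A : Type*) [Fintype A] [DecidableEq A] : Matrix (A × A) (A × A) ℂ :=
  Matrix.of fun p q => if p.1 = p.2 ∧ q.1 = q.2 then ((Fintype.card A : ℂ))⁻¹ else 0

variable {A₁ A₂ : Type*} [Fintype A₁] [DecidableEq A₁] [Fintype A₂] [DecidableEq A₂]

/-- The product of EPR states `Φ^{A₁A'₁} ⊗ Φ^{A₂A'₂}`, with the tensor factors ordered as
`(A₁ ⊗ A₂) ⊗ (A'₁ ⊗ A'₂)`. -/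
def eprPair (A₁ A₂ : Type*) [Fintype A₁] [DecidableEq A₁] [Fintype A₂] [DecidableEq A₂] :
    Matrix ((A₁ × A₂) × (A₁ × A₂)) ((A₁ × A₂) × (A₁ × A₂)) ℂ :=
  (epr A₁ ⊗ₖ epr A₂).submatrix (Equiv.prodProdProdComm A₁ A₂ A₁ A₂)
    (Equiv.prodProdProdComm A₁ A₂ A₁ A₂)

/-- The Choi state `τ = (T ⊗ 𝕀^{A'₁A'₂})(Φ^{A₁A'₁} ⊗ Φ^{A₂A'₂})`, with the tensor factors ordered
as `(A'₁ ⊗ A'₂) ⊗ B`. -/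
def choiState (T : Matrix (A₁ × A₂) (A₁ × A₂) ℂ →ₗ[ℂ] Matrix B B ℂ) :
    Matrix ((A₁ × A₂) × B) ((A₁ × A₂) × B) ℂ :=
  (ampliate (A₁ × A₂) T (eprPair A₁ A₂)).submatrix Prod.swap Prod.swap

/-- The unitarily perturbed state
`σ^{BR}(U₁, U₂) = (T ⊗ 𝕀^R)((U₁ ⊗ U₂ ⊗ 1^R) ρ (U₁ ⊗ U₂ ⊗ 1^R)†)`. -/
def perturbedState {R : Type*} [Fintype R] [DecidableEq R]
    (T : Matrix (A₁ × A₂) (A₁ × A₂) ℂ →ₗ[ℂ] Matrix B B ℂ)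
    (ρ : Matrix ((A₁ × A₂) × R) ((A₁ × A₂) × R) ℂ)
    (U₁ : Matrix A₁ A₁ ℂ) (U₂ : Matrix A₂ A₂ ℂ) : Matrix (B × R) (B × R) ℂ :=
  ampliate R T
    (((U₁ ⊗ₖ U₂) ⊗ₖ (1 : Matrix R R ℂ)) * ρ * ((U₁ ⊗ₖ U₂) ⊗ₖ (1 : Matrix R R ℂ))ᴴ)

end Superoperator

/-! ### Haar measure on the unitary group -/

section Haar

variable (n : Type*) [Fintype n] [DecidableEq n]

instance : CompactSpace (Matrix.unitaryGroup n ℂ) := by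
  apply isCompact_iff_compactSpace.mp
  have hK : IsCompact (Set.univ.pi fun _ : n => Set.univ.pi fun _ : n =>
      Metric.closedBall (0 : ℂ) 1) :=
    isCompact_univ_pi fun _ => isCompact_univ_pi fun _ => isCompact_closedBall _ _
  refine hK.of_isClosed_subset (?_ : IsClosed (unitary (Matrix n n ℂ) : Set (Matrix n n ℂ))) ?_
  · exact isClosed_unitary
  · intro U hU i _ j _
    simpa using entry_norm_bound_of_unitary hU i j

instance : MeasurableSpace (Matrix.unitaryGroup n ℂ) := borel _

instance : BorelSpace (Matrix.unitaryGroup n ℂ) := ⟨rfl⟩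

/-- The Haar probability measure on the unitary group. -/
def unitaryHaar : MeasureTheory.Measure (Matrix.unitaryGroup n ℂ) :=
  MeasureTheory.Measure.haarMeasure ⊤

end Haar

/-- The dimensional factor `(1 - |A|⁻²)^(-1/2)`. -/
def dimFactor (A : Type*) [Fintype A] : ℝ :=
  (1 - ((Fintype.card A : ℝ) ^ 2)⁻¹) ^ (-(1 / 2) : ℝ)

end Decoupling

end

open scoped Kronecker ENNReal Matrix ComplexOrder

noncomputable section

namespace Decoupling

/-! ### Trace norm and Hilbert–Schmidt norm of Hermitian matrices -/

section TraceNorm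

open scoped MatrixOrder

variable {n : Type*} [Fintype n] [DecidableEq n]

/-! Split the identity superoperator on each `A_i` as a traceless part (`center`) plus a completely
depolarising part (`depolarize`). On `A₁ ⊗ A₂` this gives four terms. The doubly depolarised term is
fixed by the unitaries and produces exactly `τ^B ⊗ ρ^R`; the two mixed terms see only one unitary
and only the marginals of `τ` and `ρ`; the last term is traceless on both factors
(`eq_centerPair_add`, `contract_conjMap_eq`). The triangle inequality leaves three decoupling
problems of the same shape, abstracted as `IsDecouplingFamily` and solved once in
`IsDecouplingFamily.lintegral_le`.

Each problem concerns an expression `contract X (V P(Y) V†)` that is bilinear in a Choi-type matrix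
`X` and a state `Y`. Two estimates carry it. (1) Hilbert–Schmidt estimate (`lintegral_le_second`).
Pull out fourth roots `Q`, `Q'` of the marginals. Hölder's inequality in the form `‖QYQ‖₁ ≤ √(Tr Q⁴)
‖Y‖₂` (`schattenNorm_one_conj_le`) replaces the trace norm by the 2-norm, Jensen passes to the
second moment, and Haar integration contracts by `(d² - 1)⁻¹` for each traceless factor. That
integral is computed from the commutant of `U ⊗ U`, spanned by the identity and the swap
(`eq_smul_one_add_smul_swapMatrix`). Multiplied by the `d²` from `contract`, it yields the squares
of the dimensional factors. (2) Trace-norm estimate (`lintegral_le_first`). Writing `P = L - L'`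
with `L`, `L'` completely positive and decomposing `X` and `Y` into positive parts bounds the norm
by a trace, whose mean follows from the first moment alone.

Smoothing replaces `X` and `Y` by nearby candidates: (1) is applied to the candidates and (2) to the
differences. Since (2) needs nothing of `X` beyond being Hermitian, a smoothed Choi state need not
come from a trace non-increasing map. The two replacements cost `2cε` in all, with `c = 2, 2, 4` in
the three problems, hence `16ε`. Taking infima over both candidates independently gives the two
smooth entropies (`le_add_mul_pow2`). -/

lemma continuousOn_spectrum (f : ℝ → ℝ) (M : Matrix n n ℂ) : ContinuousOn f (spectrum ℝ M) :=
  (Matrix.finite_real_spectrum (A := M)).continuousOn f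

lemma cfc_isHermitian (f : ℝ → ℝ) (M : Matrix n n ℂ) : (cfc f M).IsHermitian :=
  cfc_predicate f M

lemma cfc_mul_cfc (f g : ℝ → ℝ) (M : Matrix n n ℂ) :
    cfc f M * cfc g M = cfc (fun x => f x * g x) M :=
  (cfc_mul f g M (continuousOn_spectrum _ _) (continuousOn_spectrum _ _)).symm

lemma posSemidef_cfc {f : ℝ → ℝ} (hf : ∀ x, 0 ≤ f x) (M : Matrix n n ℂ) :
    (cfc f M).PosSemidef :=
  Matrix.nonneg_iff_posSemidef.mp (cfc_nonneg fun x _ => hf x)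

lemma cfc_self {M : Matrix n n ℂ} (hM : M.IsHermitian) : cfc (fun x : ℝ => x) M = M :=
  cfc_id' ℝ M (show IsSelfAdjoint M from hM)

lemma cfc_const_one_of_isHermitian {M : Matrix n n ℂ} (hM : M.IsHermitian) :
    cfc (fun _ : ℝ => (1 : ℝ)) M = 1 :=
  cfc_const_one ℝ M (show IsSelfAdjoint M from hM)

lemma nonneg_of_mem_spectrum {M : Matrix n n ℂ} (hM : M.PosSemidef) {x : ℝ}
    (hx : x ∈ spectrum ℝ M) : 0 ≤ x :=
  spectrum_nonneg_of_nonneg (Matrix.nonneg_iff_posSemidef.mpr hM) hx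

lemma schattenNorm_one_of_isHermitian {M : Matrix n n ℂ} (hM : M.IsHermitian) :
    schattenNorm 1 M = (cfc (fun x : ℝ => |x|) M).trace.re := by
  have hM' : IsSelfAdjoint M := hM
  have h : Mᴴ * M = cfc (fun x : ℝ => x * x) M := by
    rw [← cfc_mul_cfc, cfc_id' ℝ M hM', hM.eq]
  rw [schattenNorm, h, ← cfc_comp' _ _ M ((Matrix.finite_real_spectrum.image _).continuousOn _)
    (continuousOn_spectrum _ _) hM']
  norm_num
  congr 3
  ext x
  rw [← Real.sqrt_eq_rpow, Real.sqrt_mul_self_eq_abs]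

lemma schattenNorm_two (M : Matrix n n ℂ) :
    schattenNorm 2 M = √(∑ i, ∑ j, ‖M i j‖ ^ 2) := by
  have h : cfc (fun x : ℝ => x ^ ((2 : ℝ) / 2)) (Mᴴ * M) = Mᴴ * M := by
    norm_num
    exact cfc_id' ℝ _ (Matrix.isHermitian_conjTranspose_mul_self M)
  rw [schattenNorm, h, ← Real.sqrt_eq_rpow, Finset.sum_comm]
  congr 1
  simp [Matrix.trace, Matrix.mul_apply, Complex.sq_norm, Complex.normSq_apply]

lemma schattenNorm_two_nonneg (M : Matrix n n ℂ) : 0 ≤ schattenNorm 2 M := by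
  rw [schattenNorm_two]; positivity

lemma sq_schattenNorm_two (M : Matrix n n ℂ) :
    schattenNorm 2 M ^ 2 = ∑ i, ∑ j, ‖M i j‖ ^ 2 := by
  rw [schattenNorm_two, Real.sq_sqrt (by positivity)]

lemma sq_schattenNorm_two_of_isHermitian {M : Matrix n n ℂ} (hM : M.IsHermitian) :
    schattenNorm 2 M ^ 2 = (M * M).trace.re := by
  rw [sq_schattenNorm_two]
  conv_rhs => rw [← hM.eq]
  conv_rhs => rw [Matrix.trace_mul_comm, hM.eq]
  conv_rhs => enter [1, 1, 1]; rw [← hM.eq]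
  rw [Finset.sum_comm]
  simp [Matrix.trace, Matrix.mul_apply, Complex.sq_norm, Complex.normSq_apply]

lemma re_trace_mul_le (M N : Matrix n n ℂ) :
    (M * N).trace.re ≤ schattenNorm 2 M * schattenNorm 2 N := by
  have h1 : (M * N).trace.re ≤ ∑ p : n × n, ‖M p.1 p.2‖ * ‖N p.2 p.1‖ := by
    refine (Complex.re_le_norm _).trans ?_
    simp only [Matrix.trace, Matrix.diag, Matrix.mul_apply]
    rw [← Fintype.sum_prod_type' (f := fun i j => M i j * N j i)]
    exact (norm_sum_le _ _).trans (by simp)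
  refine h1.trans ((Real.sum_mul_le_sqrt_mul_sqrt _ _ _).trans (le_of_eq ?_))
  rw [schattenNorm_two, schattenNorm_two]
  congr 2
  · rw [Fintype.sum_prod_type]
  · rw [Fintype.sum_prod_type, Finset.sum_comm]

/-- The Jordan decomposition into positive and negative parts; by `schattenNorm_one_sub_le` it is
optimal among differences of positive matrices. -/
lemma exists_sub_posSemidef {M : Matrix n n ℂ} (hM : M.IsHermitian) :
    ∃ P N : Matrix n n ℂ, P.PosSemidef ∧ N.PosSemidef ∧ M = P - N ∧
      schattenNorm 1 M = (P + N).trace.re := by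
  refine ⟨cfc (fun x : ℝ => max x 0) M, cfc (fun x : ℝ => max (-x) 0) M,
    posSemidef_cfc (fun x => le_max_right _ _) M, posSemidef_cfc (fun x => le_max_right _ _) M,
    ?_, ?_⟩
  · rw [← cfc_sub _ _ M (continuousOn_spectrum _ _) (continuousOn_spectrum _ _)]
    conv_lhs => rw [← cfc_self hM]
    congr 1
    ext x
    rcases le_total x 0 with h | h <;> simp [h]
  · rw [schattenNorm_one_of_isHermitian hM,
      ← cfc_add _ _ _ (continuousOn_spectrum _ _) (continuousOn_spectrum _ _)]
    congr 3
    ext x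
    rcases le_total x 0 with h | h <;> simp [h]

lemma exists_sign {M : Matrix n n ℂ} (hM : M.IsHermitian) :
    ∃ S : Matrix n n ℂ, S.IsHermitian ∧ S * S = 1 ∧ schattenNorm 1 M = (S * M).trace.re := by
  refine ⟨cfc (fun x : ℝ => if 0 ≤ x then 1 else -1) M, cfc_isHermitian _ _, ?_, ?_⟩
  · rw [cfc_mul_cfc]
    have : (fun x : ℝ => (if 0 ≤ x then (1 : ℝ) else -1) * (if 0 ≤ x then 1 else -1)) =
      fun _ => 1 := by
      ext x; split_ifs <;> simp
    rw [this, cfc_const_one_of_isHermitian hM]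
  · rw [schattenNorm_one_of_isHermitian hM]
    nth_rewrite 3 [← cfc_self hM]
    rw [cfc_mul_cfc]
    congr 3
    ext x
    split_ifs with h
    · simp [abs_of_nonneg h]
    · simp [abs_of_neg (not_le.mp h)]

lemma re_trace_nonneg {n : Type*} [Fintype n] {M : Matrix n n ℂ} (hM : M.PosSemidef) : 0 ≤ M.trace.re :=
  (Complex.nonneg_iff.mp hM.trace_nonneg).1

/-- Since `(1 - S)² = 2(1 - S)`, the positive matrix `(1 - S) M (1 - S)` has trace `2 (Tr M - Tr
SM)`. -/
lemma re_trace_mul_le_of_sq_eq_one {S M : Matrix n n ℂ} (hS : S.IsHermitian) (hS' : S * S = 1)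
    (hM : M.PosSemidef) : (S * M).trace.re ≤ M.trace.re := by
  have h := re_trace_nonneg (hM.mul_mul_conjTranspose_same (1 - S))
  have e : ((1 - S) * M * (1 - S)ᴴ).trace = 2 * (M.trace - (S * M).trace) := by
    rw [Matrix.conjTranspose_sub, hS.eq, Matrix.conjTranspose_one, Matrix.trace_mul_comm,
      ← mul_assoc]
    have : (1 - S) * (1 - S) = (2 : ℂ) • (1 - S) := by
      rw [sub_mul, mul_sub, mul_sub, hS', two_smul]; simp; abel
    rw [this, Matrix.smul_mul, Matrix.trace_smul, sub_mul, Matrix.trace_sub, one_mul, smul_eq_mul]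
  rw [e] at h
  simp at h
  linarith

lemma schattenNorm_one_sub_le {P N : Matrix n n ℂ} (hP : P.PosSemidef) (hN : N.PosSemidef) :
    schattenNorm 1 (P - N) ≤ (P + N).trace.re := by
  obtain ⟨S, hS, hS', h⟩ := exists_sign (hP.isHermitian.sub hN.isHermitian)
  have h1 := re_trace_mul_le_of_sq_eq_one hS hS' hP
  have h2 := re_trace_mul_le_of_sq_eq_one hS.neg (by simpa using hS') hN
  rw [h, mul_sub, Matrix.trace_sub, Matrix.trace_add]
  simp at h2 ⊢
  linarith

lemma schattenNorm_one_of_posSemidef {M : Matrix n n ℂ} (hM : M.PosSemidef) :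
    schattenNorm 1 M = M.trace.re := by
  rw [schattenNorm_one_of_isHermitian hM.isHermitian]
  nth_rewrite 2 [← cfc_self hM.isHermitian]
  congr 2
  exact cfc_congr fun x hx => abs_of_nonneg (nonneg_of_mem_spectrum hM hx)

lemma schattenNorm_one_nonneg {M : Matrix n n ℂ} (hM : M.IsHermitian) : 0 ≤ schattenNorm 1 M := by
  rw [schattenNorm_one_of_isHermitian hM]
  exact re_trace_nonneg (posSemidef_cfc (fun _ => abs_nonneg _) _)

lemma schattenNorm_one_add_le {M N : Matrix n n ℂ} (hM : M.IsHermitian) (hN : N.IsHermitian) :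
    schattenNorm 1 (M + N) ≤ schattenNorm 1 M + schattenNorm 1 N := by
  obtain ⟨P, Q, hP, hQ, rfl, h⟩ := exists_sub_posSemidef hM
  obtain ⟨P', Q', hP', hQ', rfl, h'⟩ := exists_sub_posSemidef hN
  rw [h, h', sub_add_sub_comm]
  refine (schattenNorm_one_sub_le (hP.add hP') (hQ.add hQ')).trans (le_of_eq ?_)
  simp only [Matrix.trace_add, Complex.add_re]
  ring

/-- With `S` the sign of `QYQ`, the norm is `Tr (QSQ · Y)`. Cauchy–Schwarz isolates `‖QSQ‖₂`, and a
second Cauchy–Schwarz on `Tr (Q² · SQ²S)` removes `S`, because conjugation by `S` preserves the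
2-norm. -/
lemma schattenNorm_one_conj_le {Q Y : Matrix n n ℂ} (hQ : Q.IsHermitian) (hY : Y.IsHermitian) :
    schattenNorm 1 (Q * Y * Q) ≤ √((Q * Q) * (Q * Q)).trace.re * schattenNorm 2 Y := by
  have hQYQ : (Q * Y * Q).IsHermitian := by
    simpa [hQ.eq] using Matrix.isHermitian_mul_mul_conjTranspose Q hY
  obtain ⟨S, hS, hS', h⟩ := exists_sign hQYQ
  have hQSQ : (Q * S * Q).IsHermitian := by
    simpa [hQ.eq] using Matrix.isHermitian_mul_mul_conjTranspose Q hS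
  have hSQS : (S * (Q * Q) * S).IsHermitian := by
    have hQQ : (Q * Q).IsHermitian := by
      rw [Matrix.IsHermitian, Matrix.conjTranspose_mul, hQ.eq]
    simpa [hS.eq] using Matrix.isHermitian_mul_mul_conjTranspose S hQQ
  have hQQ : (Q * Q).IsHermitian := by
    rw [Matrix.IsHermitian, Matrix.conjTranspose_mul, hQ.eq]
  have e1 : (S * (Q * Y * Q)).trace = (Q * S * Q * Y).trace := by
    rw [show S * (Q * Y * Q) = (S * Q * Y) * Q by simp only [mul_assoc], Matrix.trace_mul_comm]
    simp only [mul_assoc]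
  rw [h, e1]
  refine (re_trace_mul_le _ _).trans ?_
  gcongr
  · exact schattenNorm_two_nonneg _
  refine Real.le_sqrt_of_sq_le ?_
  rw [sq_schattenNorm_two_of_isHermitian hQSQ]
  have e2 : (Q * S * Q * (Q * S * Q)).trace = ((Q * Q) * (S * (Q * Q) * S)).trace := by
    rw [show Q * S * Q * (Q * S * Q) = (Q * S * Q * Q * S) * Q by simp only [mul_assoc],
      Matrix.trace_mul_comm]
    simp only [mul_assoc]
  rw [e2]
  refine (re_trace_mul_le _ _).trans (le_of_eq ?_)
  have e3 : schattenNorm 2 (S * (Q * Q) * S) = schattenNorm 2 (Q * Q) := by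
    refine (sq_eq_sq₀ (schattenNorm_two_nonneg _) (schattenNorm_two_nonneg _)).mp ?_
    rw [sq_schattenNorm_two_of_isHermitian hSQS, sq_schattenNorm_two_of_isHermitian hQQ]
    rw [show S * (Q * Q) * S * (S * (Q * Q) * S) = S * ((Q * Q) * (S * S) * (Q * Q) * S) by
      simp only [mul_assoc], Matrix.trace_mul_comm, hS', mul_one, mul_assoc, hS', mul_one]
  rw [e3, ← sq, sq_schattenNorm_two_of_isHermitian hQQ]

lemma schattenNorm_one_le {M : Matrix n n ℂ} (hM : M.IsHermitian) :
    schattenNorm 1 M ≤ √(Fintype.card n) * schattenNorm 2 M := by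
  simpa using schattenNorm_one_conj_le (Matrix.isHermitian_one (n := n) (α := ℂ)) hM

/-- The triangle inequality bounds the variation by the trace norm of a difference, and the 2-norm,
visibly continuous in the entries, dominates it. Continuity supplies the measurability used to split
integrals. -/
lemma continuous_schattenNorm_one {X : Type*} [TopologicalSpace X] {f : X → Matrix n n ℂ}
    (hf : Continuous f) (hf' : ∀ x, (f x).IsHermitian) :
    Continuous fun x => schattenNorm 1 (f x) := by
  rw [continuous_iff_continuousAt]
  intro x
  have hb : ∀ y, dist (schattenNorm 1 (f y)) (schattenNorm 1 (f x)) ≤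
      √(Fintype.card n) * schattenNorm 2 (f y - f x) := by
    intro y
    have h1 := schattenNorm_one_add_le ((hf' y).sub (hf' x)) (hf' x)
    have h2 := schattenNorm_one_add_le ((hf' x).sub (hf' y)) (hf' y)
    have h3 := schattenNorm_one_le ((hf' y).sub (hf' x))
    have h4 := schattenNorm_one_le ((hf' x).sub (hf' y))
    have h5 : schattenNorm 2 (f x - f y) = schattenNorm 2 (f y - f x) := by
      simp only [schattenNorm_two, Matrix.sub_apply, norm_sub_rev]
    rw [sub_add_cancel] at h1 h2
    rw [h5] at h4
    rw [Real.dist_eq, abs_le]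
    constructor <;> linarith
  refine tendsto_iff_dist_tendsto_zero.mpr (squeeze_zero (fun _ => dist_nonneg) hb ?_)
  have hc : Continuous fun y => √(Fintype.card n) * schattenNorm 2 (f y - f x) := by
    simp only [schattenNorm_two, Matrix.sub_apply]
    have := fun i j => hf.matrix_elem i j
    fun_prop
  simpa [schattenNorm_two] using hc.tendsto x

end TraceNorm

/-! ### Commutants of `U` and of `U ⊗ U` -/

section Commutant

variable {n : Type*} [Fintype n] [DecidableEq n]

/-- The swap operator on two copies of a space. -/
def swapMatrix (n : Type*) [DecidableEq n] : Matrix (n × n) (n × n) ℂ :=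
  Matrix.of fun p q => if p.1 = q.2 ∧ p.2 = q.1 then 1 else 0

lemma kronecker_mul_swapMatrix (M N : Matrix n n ℂ) :
    (M ⊗ₖ N) * swapMatrix n = swapMatrix n * (N ⊗ₖ M) := by
  ext ⟨i, j⟩ ⟨k, l⟩
  simp [swapMatrix, Matrix.mul_apply, Fintype.sum_prod_type, ite_and, mul_comm]

lemma trace_kronecker_mul_swapMatrix (M N : Matrix n n ℂ) :
    ((M ⊗ₖ N) * swapMatrix n).trace = (M * N).trace := by
  simp [swapMatrix, Matrix.trace, Matrix.mul_apply, Fintype.sum_prod_type, ite_and]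

lemma trace_swapMatrix : (swapMatrix n).trace = Fintype.card n := by
  simpa using trace_kronecker_mul_swapMatrix (1 : Matrix n n ℂ) 1

lemma swapMatrix_mul_self : swapMatrix n * swapMatrix n = 1 := by
  ext ⟨i, j⟩ ⟨k, l⟩
  simp [swapMatrix, Matrix.mul_apply, Fintype.sum_prod_type, ite_and, Matrix.one_apply]

/-- The diagonal unitary with one entry `i` and the others `1`. -/
def phaseMatrix (p : n) : Matrix n n ℂ :=
  Matrix.diagonal fun i => if i = p then Complex.I else 1

lemma phaseMatrix_mem (p : n) : phaseMatrix p ∈ Matrix.unitaryGroup n ℂ := by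
  rw [Matrix.mem_unitaryGroup_iff, phaseMatrix, Matrix.star_eq_conjTranspose,
    Matrix.diagonal_conjTranspose, Matrix.diagonal_mul_diagonal, ← Matrix.diagonal_one]
  congr 1
  ext i
  by_cases h : i = p
  · subst h; simp
  · simp [h]

/-- The matrix of a permutation. -/
def permutationMatrix (σ : Equiv.Perm n) : Matrix n n ℂ :=
  Matrix.of fun i j => if σ i = j then 1 else 0

lemma permutationMatrix_mem (σ : Equiv.Perm n) :
    permutationMatrix σ ∈ Matrix.unitaryGroup n ℂ := by
  rw [Matrix.mem_unitaryGroup_iff, Matrix.star_eq_conjTranspose]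
  ext i j
  simp [permutationMatrix, Matrix.mul_apply, Matrix.one_apply, eq_comm]

/-- A reflection that mixes two coordinates. -/
def mixingMatrix (i j : n) : Matrix n n ℂ :=
  1 - (2 / 5 : ℂ) • Matrix.vecMulVec (Pi.single i 1 + Pi.single j 2) (Pi.single i 1 + Pi.single j 2)

/-- This is the Householder reflection in `e_i + 2 e_j`; the squared length 5 of that vector
explains the coefficient `2/5`. -/
lemma mixingMatrix_mem {i j : n} (hij : i ≠ j) : mixingMatrix i j ∈ Matrix.unitaryGroup n ℂ := by
  have hs : star (mixingMatrix i j) = mixingMatrix i j := by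
    rw [Matrix.star_eq_conjTranspose]
    have hr : star (Pi.single i 1 + Pi.single j 2 : n → ℂ) = Pi.single i 1 + Pi.single j 2 := by
      rw [star_add, ← Pi.single_star, ← Pi.single_star]
      simp
    rw [mixingMatrix, Matrix.conjTranspose_sub, Matrix.conjTranspose_smul,
      Matrix.conjTranspose_vecMulVec, hr]
    simp
  have hv : (Pi.single i 1 + Pi.single j 2 : n → ℂ) ⬝ᵥ (Pi.single i 1 + Pi.single j 2) = 5 := by
    simp [dotProduct_add, hij, hij.symm]
    norm_num
  rw [Matrix.mem_unitaryGroup_iff, hs, mixingMatrix, sub_mul, mul_sub, mul_sub, smul_mul_smul_comm,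
    Matrix.vecMulVec_mul_vecMulVec, hv]
  simp only [one_mul, mul_one, Matrix.vecMulVec_smul, smul_smul]
  module

/-- Schur's lemma by hand: phases kill the off-diagonal entries and permutations equalise the
diagonal ones. -/
lemma eq_smul_one_of_commute [Nonempty n] {N : Matrix n n ℂ}
    (h : ∀ W ∈ Matrix.unitaryGroup n ℂ, W * N = N * W) :
    N = (N.trace / Fintype.card n) • 1 := by
  have hoff : ∀ i j, i ≠ j → N i j = 0 := by
    intro i j hij
    have := congrFun₂ (h _ (phaseMatrix_mem i)) i j
    simp only [phaseMatrix, Matrix.diagonal_mul, Matrix.mul_diagonal, if_true,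
      if_neg hij.symm, mul_one] at this
    have h1 : (Complex.I - 1) * N i j = 0 := by rw [sub_mul, this]; ring
    rcases mul_eq_zero.mp h1 with h2 | h2
    · have := congrArg Complex.re h2
      simp at this
    · exact h2
  have hperm : ∀ (σ : Equiv.Perm n) i, N (σ i) (σ i) = N i i := by
    intro σ i
    have := congrFun₂ (h _ (permutationMatrix_mem σ)) i (σ i)
    simpa [permutationMatrix, Matrix.mul_apply] using this
  have hdiag : ∀ i j, N i i = N j j := by
    intro i j
    simpa using hperm (Equiv.swap j i) j
  obtain ⟨i₀⟩ := ‹Nonempty n›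
  have ht : N.trace = Fintype.card n * N i₀ i₀ := by
    simp [Matrix.trace, hdiag _ i₀]
  have hd : (Fintype.card n : ℂ) ≠ 0 := by
    simp
  ext i j
  rw [ht, mul_div_cancel_left₀ _ hd]
  by_cases hij : i = j
  · subst hij; simp [hdiag i i₀]
  · simp [hij, hoff i j hij]

lemma exists_perm_apply_eq {n : Type*} [DecidableEq n] {i j k l : n} (hij : i ≠ j) (hkl : k ≠ l) :
    ∃ σ : Equiv.Perm n, σ i = k ∧ σ j = l := by
  refine ⟨(Equiv.swap i k).trans (Equiv.swap (Equiv.swap i k j) l), ?_, by simp⟩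
  have : k ≠ Equiv.swap i k j := by
    rw [ne_comm, Ne, Equiv.swap_apply_eq_iff]
    simpa using hij.symm
  simp [Equiv.swap_apply_of_ne_of_ne this hkl]

/-- The factor at `p` is `1`, `I` or `-1` according to the multiplicity of `p` in the pair. These
are distinct, so the phases recover the unordered pair; a phase `-1` in place of `I` could not tell
multiplicity 0 from 2. -/
lemma eq_of_phases {n : Type*} [DecidableEq n] {i j k l : n}
    (h : ∀ p : n, (if i = p then Complex.I else 1) * (if j = p then Complex.I else 1) =
      (if k = p then Complex.I else 1) * (if l = p then Complex.I else 1)) :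
    (i = k ∧ j = l) ∨ (i = l ∧ j = k) := by
  have h1 : Complex.I ≠ 1 := fun h => by simpa using congrArg Complex.re h
  have h2 : Complex.I ≠ -1 := fun h => by simpa using congrArg Complex.re h
  have h3 : (-1 : ℂ) ≠ 1 := by norm_num
  have h4 := Complex.I_mul_I
  have hi := h i
  have hj := h j
  grind

/-- Phases leave only entries whose row and column agree as unordered pairs; permutations reduce
these to three constants `a`, `b`, `c`. One unitary outside the monomial group then forces `c = a +
b`. -/
lemma eq_smul_one_add_smul_swapMatrix [Nontrivial n] {N : Matrix (n × n) (n × n) ℂ}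
    (h : ∀ W ∈ Matrix.unitaryGroup n ℂ, (W ⊗ₖ W) * N = N * (W ⊗ₖ W)) :
    ∃ a b : ℂ, N = a • 1 + b • swapMatrix n := by
  have hzero : ∀ i j k l, ¬ ((i = k ∧ j = l) ∨ (i = l ∧ j = k)) → N (i, j) (k, l) = 0 := by
    intro i j k l hn
    by_contra hN
    refine hn (eq_of_phases fun p => ?_)
    have := congrFun₂ (h _ (phaseMatrix_mem p)) (i, j) (k, l)
    rw [phaseMatrix, Matrix.diagonal_kronecker_diagonal, Matrix.diagonal_mul,
      Matrix.mul_diagonal, mul_comm] at this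
    exact mul_left_cancel₀ hN this
  have hperm : ∀ (σ : Equiv.Perm n) i j k l,
      N (σ i, σ j) (σ k, σ l) = N (i, j) (k, l) := by
    intro σ i j k l
    have := congrFun₂ (h _ (permutationMatrix_mem σ)) (i, j) (σ k, σ l)
    simpa [permutationMatrix, Matrix.mul_apply, Fintype.sum_prod_type, ite_and] using this
  obtain ⟨i₀, j₀, h₀⟩ := exists_pair_ne n
  set a := N (i₀, j₀) (i₀, j₀) with ha
  set b := N (i₀, j₀) (j₀, i₀) with hb
  set c := N (i₀, i₀) (i₀, i₀) with hc
  have hN : N = a • 1 + b • swapMatrix n +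
      (c - a - b) • Matrix.diagonal (fun p : n × n => if p.1 = p.2 then (1 : ℂ) else 0) := by
    ext ⟨i, j⟩ ⟨k, l⟩
    by_cases hij : i = j
    · subst hij
      by_cases hk : i = k ∧ i = l
      · obtain ⟨rfl, rfl⟩ := hk
        have := hperm (Equiv.swap i₀ i) i₀ i₀ i₀ i₀
        rw [Equiv.swap_apply_left] at this
        rw [this]
        simp [swapMatrix]
        ring
      · rw [hzero _ _ _ _ (by tauto)]
        simp [swapMatrix, Matrix.one_apply, Matrix.diagonal_apply]
        rw [if_neg hk, if_neg (by tauto), if_neg hk]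
        simp
    · obtain ⟨σ, hi, hj⟩ := exists_perm_apply_eq h₀ hij
      by_cases hk : i = k ∧ j = l
      · obtain ⟨rfl, rfl⟩ := hk
        have := hperm σ i₀ j₀ i₀ j₀
        rw [hi, hj] at this
        rw [this]
        simp [swapMatrix, hij, ha]
      · by_cases hl : i = l ∧ j = k
        · obtain ⟨rfl, rfl⟩ := hl
          have := hperm σ i₀ j₀ j₀ i₀
          rw [hi, hj] at this
          rw [this]
          simp [swapMatrix, hij, hb]
        · rw [hzero _ _ _ _ (by tauto)]
          simp [swapMatrix, hk, hl]
  refine ⟨a, b, ?_⟩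
  -- The identity and the swap commute with `W ⊗ W`, so this entry of the commutation relation tests
  -- only the diagonal correction: one side has it acting on the column `(i₀, j₀)`, where it
  -- vanishes, the other on the row `(i₀, i₀)`, where it is 1.
  have hmix := congrFun₂ (h _ (mixingMatrix_mem h₀)) (i₀, i₀) (i₀, j₀)
  rw [hN] at hmix
  simp only [mul_add, add_mul, Matrix.mul_smul, Matrix.smul_mul, mul_one, one_mul,
    kronecker_mul_swapMatrix, Matrix.add_apply, Matrix.smul_apply, Matrix.mul_diagonal,
    Matrix.diagonal_mul, if_neg h₀, if_true, mul_zero, smul_zero, add_zero,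
    Matrix.kroneckerMap_apply] at hmix
  -- The two entries are `3/5` and `-4/5`. Reflecting in `e_i + e_j` would make the diagonal entry
  -- zero, which is why the coordinates are weighted unequally.
  have hne : mixingMatrix i₀ j₀ i₀ i₀ * mixingMatrix i₀ j₀ i₀ j₀ ≠ 0 := by
    simp [mixingMatrix, Matrix.vecMulVec_apply, h₀, h₀.symm]
    norm_num
  have h0 := add_eq_left.mp hmix.symm
  rw [smul_eq_mul] at h0
  rw [hN, (mul_eq_zero.mp h0).resolve_right hne]
  simp

end Commutant

open MeasureTheory

/-! ### Entrywise integration of matrix-valued functions -/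

section Integral

lemma integrable_of_continuous {Ω : Type*} [TopologicalSpace Ω] [CompactSpace Ω]
    [MeasurableSpace Ω] [OpensMeasurableSpace Ω] (μ : Measure Ω) [IsProbabilityMeasure μ]
    {E : Type*} [NormedAddCommGroup E] [SecondCountableTopology E] {f : Ω → E} (hf : Continuous f) :
    Integrable f μ := by
  borelize E
  obtain ⟨C, hC⟩ := (isCompact_range hf).isBounded.exists_norm_le
  exact Integrable.of_bound hf.measurable.aestronglyMeasurable C
    (.of_forall fun x => hC _ ⟨x, rfl⟩)

variable {Ω : Type*} [MeasurableSpace Ω] (μ : Measure Ω) {m n p : Type*}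

/-- The entrywise integral of a matrix-valued function. -/
def matrixIntegral (F : Ω → Matrix m n ℂ) : Matrix m n ℂ :=
  Matrix.of fun i j => ∫ ω, F ω i j ∂μ

variable {μ}

lemma mul_matrixIntegral [Fintype m] (C : Matrix p m ℂ) {F : Ω → Matrix m n ℂ}
    (hF : ∀ i j, Integrable (fun ω => F ω i j) μ) :
    C * matrixIntegral μ F = matrixIntegral μ fun ω => C * F ω := by
  ext i j
  simp only [matrixIntegral, Matrix.mul_apply, Matrix.of_apply]
  rw [integral_finsetSum _ fun k _ => (hF k j).const_mul _]
  simp only [integral_const_mul]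

lemma matrixIntegral_mul [Fintype n] (C : Matrix n p ℂ) {F : Ω → Matrix m n ℂ}
    (hF : ∀ i j, Integrable (fun ω => F ω i j) μ) :
    matrixIntegral μ F * C = matrixIntegral μ fun ω => F ω * C := by
  ext i j
  simp only [matrixIntegral, Matrix.mul_apply, Matrix.of_apply]
  rw [integral_finsetSum _ fun k _ => (hF i k).mul_const _]
  simp only [integral_mul_const]

lemma trace_matrixIntegral [Fintype n] {F : Ω → Matrix n n ℂ}
    (hF : ∀ i j, Integrable (fun ω => F ω i j) μ) :
    (matrixIntegral μ F).trace = ∫ ω, (F ω).trace ∂μ := by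
  simp only [matrixIntegral, Matrix.trace, Matrix.diag, Matrix.of_apply]
  rw [integral_finsetSum _ fun k _ => hF k k]

end Integral

/-! ### First and second moments of the Haar measure -/

section Haar

variable {n : Type*} [Fintype n] [DecidableEq n]

instance : SecondCountableTopology (Matrix.unitaryGroup n ℂ) :=
  inferInstanceAs (SecondCountableTopology
    {U : n → n → ℂ // U ∈ (Matrix.unitaryGroup n ℂ : Set (Matrix n n ℂ))})

instance : (unitaryHaar n).IsMulLeftInvariant := by
  unfold unitaryHaar; infer_instance

instance : IsProbabilityMeasure (unitaryHaar n) where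
  measure_univ := by
    simpa [unitaryHaar] using Measure.haarMeasure_self
      (K₀ := (⊤ : TopologicalSpace.PositiveCompacts (Matrix.unitaryGroup n ℂ)))

lemma star_mul_coe (U : Matrix.unitaryGroup n ℂ) : (U : Matrix n n ℂ)ᴴ * (U : Matrix n n ℂ) = 1 :=
  Matrix.mem_unitaryGroup_iff'.mp U.2

lemma continuous_conj_entry {Ω : Type*} [TopologicalSpace Ω] {m : Type*} [Fintype m]
    {V : Ω → Matrix m m ℂ} (hV : Continuous V) (Z : Matrix m m ℂ) (i j : m) :
    Continuous fun ω => (V ω * Z * (V ω)ᴴ) i j :=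
  ((hV.matrix_mul continuous_const).matrix_mul hV.matrix_conjTranspose).matrix_elem i j

lemma continuous_kronecker {Ω : Type*} [TopologicalSpace Ω] {m m' : Type*}
    {V : Ω → Matrix m m ℂ} {W : Ω → Matrix m' m' ℂ} (hV : Continuous V) (hW : Continuous W) :
    Continuous fun ω => V ω ⊗ₖ W ω :=
  continuous_matrix fun _ _ => (hV.matrix_elem _ _).mul (hW.matrix_elem _ _)

/-- A representation twirl commutes with the representation. -/
lemma commute_matrixIntegral {m : Type*} [Fintype m] [DecidableEq m]
    (π : Matrix n n ℂ →* Matrix m m ℂ)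
    (hπ : Continuous π) (hπ' : ∀ W, π Wᴴ = (π W)ᴴ) (Z : Matrix m m ℂ)
    (W : Matrix n n ℂ) (hW : W ∈ Matrix.unitaryGroup n ℂ) :
    π W * matrixIntegral (unitaryHaar n) (fun U => π U * Z * (π U)ᴴ) =
      matrixIntegral (unitaryHaar n) (fun U => π U * Z * (π U)ᴴ) * π W := by
  have hint : ∀ i j, Integrable (fun U : Matrix.unitaryGroup n ℂ => (π U * Z * (π U)ᴴ) i j)
      (unitaryHaar n) := fun i j => integrable_of_continuous _
        (continuous_conj_entry (hπ.comp continuous_subtype_val) Z i j)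
  have hinv : matrixIntegral (unitaryHaar n) (fun U => π U * Z * (π U)ᴴ) =
      matrixIntegral (unitaryHaar n) (fun U => π W * (π U * Z * (π U)ᴴ) * (π W)ᴴ) := by
    ext i j
    simp only [matrixIntegral, Matrix.of_apply]
    -- Left invariance of Haar measure absorbs `W` into the integration variable.
    rw [← integral_mul_left_eq_self _ (⟨W, hW⟩ : Matrix.unitaryGroup n ℂ)]
    simp [Matrix.conjTranspose_mul, mul_assoc]
  have h1 : (π W)ᴴ * π W = 1 := by
    rw [← hπ', ← map_mul, star_mul_coe ⟨W, hW⟩, map_one]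
  conv_rhs => rw [hinv]
  rw [matrixIntegral_mul, mul_matrixIntegral _ hint]
  · simp only [mul_assoc, h1, mul_one]
  · intro i j
    simp only [← mul_assoc]
    refine integrable_of_continuous _ ?_
    have := continuous_conj_entry ((continuous_const (y := π W)).matrix_mul
      (hπ.comp (continuous_subtype_val (p := (· ∈ Matrix.unitaryGroup n ℂ))))) Z i j
    simpa [Matrix.conjTranspose_mul, mul_assoc] using this

lemma integral_conj_apply [Nonempty n] (Z : Matrix n n ℂ) (i j : n) :
    ∫ U, ((U : Matrix n n ℂ) * Z * (U : Matrix n n ℂ)ᴴ) i j ∂(unitaryHaar n) =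
      if i = j then Z.trace / Fintype.card n else 0 := by
  have hN := eq_smul_one_of_commute (commute_matrixIntegral (n := n) (MonoidHom.id _) continuous_id
    (fun _ => rfl) Z)
  rw [trace_matrixIntegral] at hN
  · have := congrFun₂ hN i j
    simp only [MonoidHom.id_apply, matrixIntegral, Matrix.of_apply] at this
    rw [this]
    simp only [Matrix.trace_mul_comm _ ((_ : Matrix n n ℂ)ᴴ), ← mul_assoc, star_mul_coe, one_mul]
    simp [Matrix.one_apply]
  · exact fun _ _ => integrable_of_continuous _
      (continuous_conj_entry continuous_subtype_val Z _ _)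

/-- The representation `U ↦ U ⊗ U`. -/
def kroneckerSelf (n : Type*) [Fintype n] [DecidableEq n] :
    Matrix n n ℂ →* Matrix (n × n) (n × n) ℂ where
  toFun U := U ⊗ₖ U
  map_one' := Matrix.one_kronecker_one
  map_mul' U V := Matrix.mul_kronecker_mul U V U V

/-- The twirl is `a·1 + b·F` with `F` the swap. Its trace and its trace against `F` are those of
`Z`, giving `a d² + b d = 0` and `a d + b d² = Tr(ZF)`; the first has zero right-hand side because
`Z` is traceless. -/
lemma integral_conj_kroneckerSelf [Nontrivial n] (Z : Matrix (n × n) (n × n) ℂ)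
    (hZ : Z.trace = 0) (i j : n × n) :
    ∫ U, (kroneckerSelf n U * Z * (kroneckerSelf n U)ᴴ) i j ∂(unitaryHaar n) =
      ((Z * swapMatrix n).trace / ((Fintype.card n : ℂ) ^ 2 - 1)) *
        (swapMatrix n i j - (Fintype.card n : ℂ)⁻¹ * (1 : Matrix _ _ ℂ) i j) := by
  have hπ : Continuous (kroneckerSelf n) := continuous_kronecker continuous_id continuous_id
  have hπ' : ∀ W, kroneckerSelf n Wᴴ = (kroneckerSelf n W)ᴴ := fun W =>
    (Matrix.conjTranspose_kronecker W W).symm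
  have hint : ∀ i j, Integrable (fun U : Matrix.unitaryGroup n ℂ =>
      (kroneckerSelf n U * Z * (kroneckerSelf n U)ᴴ) i j) (unitaryHaar n) :=
    fun i j => integrable_of_continuous _
      (continuous_conj_entry (hπ.comp continuous_subtype_val) Z i j)
  have h1 : ∀ U : Matrix.unitaryGroup n ℂ, (kroneckerSelf n U)ᴴ * kroneckerSelf n U = 1 := by
    intro U
    rw [← hπ', ← map_mul, star_mul_coe, map_one]
  have hswap : ∀ U, kroneckerSelf n U * swapMatrix n = swapMatrix n * kroneckerSelf n U :=
    fun U => kronecker_mul_swapMatrix U U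
  obtain ⟨a, b, hN⟩ := eq_smul_one_add_smul_swapMatrix
    (commute_matrixIntegral (n := n) (kroneckerSelf n) hπ hπ' Z)
  have ht1 := trace_matrixIntegral hint
  have ht2 := congrArg Matrix.trace (matrixIntegral_mul (swapMatrix n) hint)
  rw [trace_matrixIntegral] at ht2
  swap
  · intro i j
    refine integrable_of_continuous _ ?_
    exact (((((hπ.comp continuous_subtype_val).matrix_mul continuous_const).matrix_mul
      (hπ.comp continuous_subtype_val).matrix_conjTranspose)).matrix_mul
        continuous_const).matrix_elem i j
  have e1 : ∀ U : Matrix.unitaryGroup n ℂ,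
      (kroneckerSelf n U * Z * (kroneckerSelf n U)ᴴ).trace = 0 := by
    intro U
    rw [Matrix.trace_mul_comm, ← mul_assoc, h1, one_mul, hZ]
  have e2 : ∀ U : Matrix.unitaryGroup n ℂ,
      (kroneckerSelf n U * Z * (kroneckerSelf n U)ᴴ * swapMatrix n).trace =
        (Z * swapMatrix n).trace := by
    intro U
    rw [mul_assoc, mul_assoc, Matrix.trace_mul_comm, mul_assoc, mul_assoc, ← hswap,
      ← mul_assoc _ (kroneckerSelf n _), h1, one_mul]
  simp only [e1, e2] at ht1 ht2
  rw [hN] at ht1 ht2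
  simp only [Matrix.trace_add, Matrix.trace_smul, Matrix.trace_one, trace_swapMatrix,
    add_mul, Matrix.smul_mul, one_mul, swapMatrix_mul_self, smul_eq_mul, integral_const,
    probReal_univ, one_smul, Fintype.card_prod, Nat.cast_mul] at ht1 ht2
  have hd : (1 : ℝ) < Fintype.card n := by exact_mod_cast Fintype.one_lt_card (α := n)
  have hd0 : (Fintype.card n : ℂ) ≠ 0 := by simp
  have hd1 : (Fintype.card n : ℂ) ^ 2 - 1 ≠ 0 := by
    have : ((Fintype.card n : ℝ) ^ 2 - 1) ≠ 0 := by nlinarith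
    exact_mod_cast this
  have ha : a = -b / Fintype.card n := by
    field_simp
    refine mul_left_cancel₀ hd0 ?_
    linear_combination ht1
  have hb : b = (Z * swapMatrix n).trace / ((Fintype.card n : ℂ) ^ 2 - 1) := by
    rw [eq_div_iff hd1, ← ht2, ha]
    field_simp
    ring
  have := congrFun₂ hN i j
  simp only [matrixIntegral, Matrix.of_apply] at this
  rw [this, ha, ← hb]
  simp only [Matrix.add_apply, Matrix.smul_apply, smul_eq_mul]
  field_simp
  ring

/-- The product of a trace and a conjugate trace is one trace on the doubled space, so the `U ⊗ U`
twirl applies. The second factor on the right is the Hilbert–Schmidt pairing of the traceless parts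
of `X` and `X'`. -/
lemma integral_trace_mul_star_trace [Nontrivial n] (X X' Y Y' : Matrix n n ℂ)
    (hY : Y.trace = 0) :
    ∫ U, (X * ((U : Matrix n n ℂ) * Y * (U : Matrix n n ℂ)ᴴ)).trace *
        star (X' * ((U : Matrix n n ℂ) * Y' * (U : Matrix n n ℂ)ᴴ)).trace ∂(unitaryHaar n) =
      ((Y * Y'ᴴ).trace / ((Fintype.card n : ℂ) ^ 2 - 1)) *
        ((X * X'ᴴ).trace - (Fintype.card n : ℂ)⁻¹ * (X.trace * star X'.trace)) := by
  have hint : ∀ i j, Integrable (fun U : Matrix.unitaryGroup n ℂ =>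
      (kroneckerSelf n U * (Y ⊗ₖ Y'ᴴ) * (kroneckerSelf n U)ᴴ) i j) (unitaryHaar n) :=
    fun i j => integrable_of_continuous _
      (continuous_conj_entry ((continuous_kronecker continuous_id continuous_id :
        Continuous (kroneckerSelf n)).comp continuous_subtype_val) _ i j)
  have hU : ∀ U : Matrix.unitaryGroup n ℂ,
      (X * ((U : Matrix n n ℂ) * Y * (U : Matrix n n ℂ)ᴴ)).trace *
        star (X' * ((U : Matrix n n ℂ) * Y' * (U : Matrix n n ℂ)ᴴ)).trace =
      ((X ⊗ₖ X'ᴴ) * (kroneckerSelf n U * (Y ⊗ₖ Y'ᴴ) * (kroneckerSelf n U)ᴴ)).trace := by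
    intro U
    rw [← Matrix.trace_conjTranspose, Matrix.conjTranspose_mul, Matrix.conjTranspose_mul,
      Matrix.conjTranspose_mul, Matrix.conjTranspose_conjTranspose, Matrix.trace_mul_comm _ X'ᴴ,
      ← Matrix.trace_kronecker]
    simp only [kroneckerSelf, MonoidHom.coe_mk, OneHom.coe_mk, Matrix.conjTranspose_kronecker,
      ← Matrix.mul_kronecker_mul, mul_assoc]
  simp only [hU]
  have h := congrArg Matrix.trace (mul_matrixIntegral (X ⊗ₖ X'ᴴ) hint)
  rw [trace_matrixIntegral] at h
  swap
  · intro i j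
    simp only [Matrix.mul_apply (M := X ⊗ₖ X'ᴴ)]
    exact integrable_finsetSum _ fun k _ => (hint k j).const_mul _
  have hM : matrixIntegral (unitaryHaar n)
      (fun U => kroneckerSelf n U * (Y ⊗ₖ Y'ᴴ) * (kroneckerSelf n U)ᴴ) =
      ((Y * Y'ᴴ).trace / ((Fintype.card n : ℂ) ^ 2 - 1)) •
        (swapMatrix n - (Fintype.card n : ℂ)⁻¹ • 1) := by
    ext i j
    rw [matrixIntegral, Matrix.of_apply, integral_conj_kroneckerSelf _ (by
      rw [Matrix.trace_kronecker, hY, zero_mul]), trace_kronecker_mul_swapMatrix]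
    simp
  rw [← h, hM, Matrix.mul_smul, Matrix.trace_smul, mul_sub, Matrix.trace_sub,
    trace_kronecker_mul_swapMatrix, Matrix.mul_smul, mul_one, Matrix.trace_smul,
    Matrix.trace_kronecker, Matrix.trace_conjTranspose]
  simp only [smul_eq_mul]

end Haar

/-! ### Traceless parts and mean squares of trace pairings -/

section SecondMoment

variable {n : Type*} [Fintype n] [DecidableEq n]

/-- The square of the Frobenius norm. -/
def frobSq {n : Type*} [Fintype n] (M : Matrix n n ℂ) : ℝ := ∑ i, ∑ j, ‖M i j‖ ^ 2

lemma frobSq_nonneg {n : Type*} [Fintype n] (M : Matrix n n ℂ) : 0 ≤ frobSq M := by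
  unfold frobSq; positivity

lemma trace_mul_conjTranspose {n : Type*} [Fintype n] (M N : Matrix n n ℂ) :
    (M * Nᴴ).trace = ∑ t : n × n, M t.1 t.2 * star (N t.1 t.2) := by
  simp [Matrix.trace, Matrix.mul_apply, Fintype.sum_prod_type]

lemma ofReal_frobSq {n : Type*} [Fintype n] (M : Matrix n n ℂ) :
    ((frobSq M : ℝ) : ℂ) = (M * Mᴴ).trace := by
  simp [trace_mul_conjTranspose, Fintype.sum_prod_type, frobSq, Complex.mul_conj']

/-- The completely depolarising map. -/
def depolarize (n : Type*) [Fintype n] [DecidableEq n] : Matrix n n ℂ →ₗ[ℂ] Matrix n n ℂ :=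
  (Fintype.card n : ℂ)⁻¹ • (Matrix.traceLinearMap n ℂ ℂ).smulRight 1

/-- The projection onto the traceless part. -/
def center (n : Type*) [Fintype n] [DecidableEq n] : Matrix n n ℂ →ₗ[ℂ] Matrix n n ℂ :=
  LinearMap.id - depolarize n

lemma depolarize_apply (Z : Matrix n n ℂ) :
    depolarize n Z = ((Fintype.card n : ℂ)⁻¹ * Z.trace) • 1 := by
  simp [depolarize, smul_smul]

lemma trace_depolarize [Nonempty n] (Z : Matrix n n ℂ) : (depolarize n Z).trace = Z.trace := by
  simp [depolarize_apply]
  field_simp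

lemma trace_center [Nonempty n] (Z : Matrix n n ℂ) : (center n Z).trace = 0 := by
  simp [center, trace_depolarize]

lemma trace_center_mul_conjTranspose [Nonempty n] (X Y : Matrix n n ℂ) :
    (center n X * (center n Y)ᴴ).trace =
      (X * Yᴴ).trace - (Fintype.card n : ℂ)⁻¹ * (X.trace * star Y.trace) := by
  have h1 : (center n X * (center n Y)ᴴ).trace = (X * (center n Y)ᴴ).trace := by
    conv_lhs => enter [1, 1]; rw [center]
    rw [LinearMap.sub_apply, sub_mul, Matrix.trace_sub, depolarize_apply, Matrix.smul_mul, one_mul,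
      Matrix.trace_smul, Matrix.trace_conjTranspose, trace_center]
    simp
  rw [h1, center, LinearMap.sub_apply, Matrix.conjTranspose_sub, mul_sub, Matrix.trace_sub,
    depolarize_apply]
  simp
  ring

/-- Pythagoras: `center` is an orthogonal projection for the Hilbert–Schmidt inner product. -/
lemma frobSq_center_le [Nonempty n] (Z : Matrix n n ℂ) : frobSq (center n Z) ≤ frobSq Z := by
  have h : ((frobSq (center n Z) : ℝ) : ℂ) =
      ((frobSq Z - (Fintype.card n : ℝ)⁻¹ * ‖Z.trace‖ ^ 2 : ℝ) : ℂ) := by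
    rw [ofReal_frobSq, trace_center_mul_conjTranspose]
    simp [ofReal_frobSq, Complex.mul_conj']
  rw [Complex.ofReal_inj.mp h]
  have : 0 ≤ (Fintype.card n : ℝ)⁻¹ * ‖Z.trace‖ ^ 2 := by positivity
  linarith

/-- The squared norm of `∑ f_i ⊗ g_i`, expanded as a double sum of products of Gram matrix entries.
-/
lemma sum_sq_norm_sum {ι κ κ' : Type*} [Fintype ι] [Fintype κ] [Fintype κ']
    (f : ι → κ → ℂ) (g : ι → κ' → ℂ) :
    ((∑ s, ∑ t, ‖∑ i, f i s * g i t‖ ^ 2 : ℝ) : ℂ) =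
      ∑ i, ∑ j, (∑ t, g i t * star (g j t)) * ∑ s, f i s * star (f j s) := by
  have h : ∀ s t, ((‖∑ i, f i s * g i t‖ ^ 2 : ℝ) : ℂ) =
      ∑ i, ∑ j, (g i t * star (g j t)) * (f i s * star (f j s)) := by
    intro s t
    rw [Complex.ofReal_pow, ← Complex.mul_conj', map_sum, Finset.sum_mul_sum]
    refine Finset.sum_congr rfl fun i _ => Finset.sum_congr rfl fun j _ => ?_
    simp
    ring
  simp only [Complex.ofReal_sum, h, Finset.sum_mul_sum]
  rw [Finset.sum_congr rfl fun s _ => Finset.sum_comm, Finset.sum_comm]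
  refine Finset.sum_congr rfl fun i _ => ?_
  rw [Finset.sum_congr rfl fun s _ => Finset.sum_comm, Finset.sum_comm]
  exact Finset.sum_congr rfl fun j _ => Finset.sum_comm

lemma continuous_trace_mul_conj {Ω : Type*} [TopologicalSpace Ω] {m : Type*} [Fintype m]
    {V : Ω → Matrix m m ℂ} (hV : Continuous V) (X Z : Matrix m m ℂ) :
    Continuous fun ω => (X * (V ω * Z * (V ω)ᴴ)).trace :=
  (continuous_const.matrix_mul
    ((hV.matrix_mul continuous_const).matrix_mul hV.matrix_conjTranspose)).matrix_trace

lemma continuous_sq_norm_trace {Ω : Type*} [TopologicalSpace Ω] {m : Type*} [Fintype m]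
    {V : Ω → Matrix m m ℂ} (hV : Continuous V) (X Z : Matrix m m ℂ) :
    Continuous fun ω => ‖(X * (V ω * Z * (V ω)ᴴ)).trace‖ ^ 2 :=
  (continuous_trace_mul_conj hV X Z).norm.pow 2

/-- The covariances of the summands are products of Gram entries, which reassemble into the norm of
`∑ center X_i ⊗ Y_i`. Keeping the sum over `i` inside the modulus, as an equality, is what allows a
second independent unitary to be averaged afterwards. -/
lemma integral_sq_norm_sum_trace [Nontrivial n] {ι : Type*} [Fintype ι] (X Y : ι → Matrix n n ℂ)
    (hY : ∀ i, (Y i).trace = 0) :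
    ∫ U, ‖∑ i, (X i * ((U : Matrix n n ℂ) * Y i * (U : Matrix n n ℂ)ᴴ)).trace‖ ^ 2
        ∂(unitaryHaar n) =
      ((Fintype.card n : ℝ) ^ 2 - 1)⁻¹ * ∑ s : n × n, ∑ t : n × n,
        ‖∑ i, center n (X i) s.1 s.2 * Y i t.1 t.2‖ ^ 2 := by
  rw [← Complex.ofReal_inj, ← integral_complex_ofReal, Complex.ofReal_mul,
    sum_sq_norm_sum (fun i (s : n × n) => center n (X i) s.1 s.2)
      (fun i (t : n × n) => Y i t.1 t.2)]
  simp only [← trace_mul_conjTranspose, trace_center_mul_conjTranspose,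
    Complex.ofReal_pow, ← Complex.mul_conj', map_sum, Finset.sum_mul_sum]
  have hint : ∀ i j, Integrable (fun U : Matrix.unitaryGroup n ℂ =>
      (X i * ((U : Matrix n n ℂ) * Y i * (U : Matrix n n ℂ)ᴴ)).trace *
        (starRingEnd ℂ) (X j * ((U : Matrix n n ℂ) * Y j * (U : Matrix n n ℂ)ᴴ)).trace)
        (unitaryHaar n) := fun i j => integrable_of_continuous _
    ((continuous_trace_mul_conj continuous_subtype_val _ _).mul
      (Complex.continuous_conj.comp (continuous_trace_mul_conj continuous_subtype_val _ _)))
  rw [integral_finsetSum _ fun i _ => integrable_finsetSum _ fun j _ => hint i j, Finset.mul_sum]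
  refine Finset.sum_congr rfl fun i _ => ?_
  rw [integral_finsetSum _ fun j _ => hint i j, Finset.mul_sum]
  refine Finset.sum_congr rfl fun j _ => ?_
  refine (integral_trace_mul_star_trace (X i) (X j) (Y i) (Y j) (hY i)).trans ?_
  push_cast
  ring

lemma one_lt_card_real {n : Type*} [Fintype n] [Nontrivial n] : (1 : ℝ) < Fintype.card n := by
  exact_mod_cast Fintype.one_lt_card (α := n)

lemma card_sq_sub_one_pos {n : Type*} [Fintype n] [Nontrivial n] : 0 < (Fintype.card n : ℝ) ^ 2 - 1 := by
  nlinarith [one_lt_card_real (n := n)]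

lemma integral_sq_norm_trace_le [Nontrivial n] (X Y : Matrix n n ℂ) (hY : Y.trace = 0) :
    ∫ U, ‖(X * ((U : Matrix n n ℂ) * Y * (U : Matrix n n ℂ)ᴴ)).trace‖ ^ 2 ∂(unitaryHaar n) ≤
      ((Fintype.card n : ℝ) ^ 2 - 1)⁻¹ * (frobSq X * frobSq Y) := by
  have h := integral_sq_norm_sum_trace (fun _ : Unit => X) (fun _ => Y) (fun _ => hY)
  simp only [Finset.univ_unique, Finset.sum_singleton, norm_mul, mul_pow,
    ← Finset.sum_mul_sum] at h
  rw [h]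
  have := card_sq_sub_one_pos (n := n)
  have h1 := frobSq_center_le X
  have h2 := frobSq_nonneg Y
  simp only [Fintype.sum_prod_type]
  change _ * (frobSq _ * frobSq _) ≤ _
  gcongr

end SecondMoment

/-! ### Second moment for a product of two independent unitaries -/

section Pair

variable {m n : Type*} [Fintype m] [DecidableEq m] [Fintype n] [DecidableEq n]

/-- The block of an operator on `m ⊗ n` at a pair of basis vectors of `m`. -/
def blockFst {m n : Type*} (M : Matrix (m × n) (m × n) ℂ) (i j : m) : Matrix n n ℂ :=
  Matrix.of fun p q => M (i, p) (j, q)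

/-- The block of an operator on `m ⊗ n` at a pair of basis vectors of `n`. -/
def blockSnd {m n : Type*} (M : Matrix (m × n) (m × n) ℂ) (p q : n) : Matrix m m ℂ :=
  Matrix.of fun i j => M (i, p) (j, q)

lemma sum_frobSq_blockFst {m n : Type*} [Fintype m] [Fintype n]
    (M : Matrix (m × n) (m × n) ℂ) :
    ∑ i, ∑ j, frobSq (blockFst M i j) = frobSq M := by
  simp only [frobSq, blockFst, Matrix.of_apply, Fintype.sum_prod_type]
  exact Finset.sum_congr rfl fun i _ => Finset.sum_comm

lemma sum_frobSq_blockSnd {m n : Type*} [Fintype m] [Fintype n]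
    (M : Matrix (m × n) (m × n) ℂ) :
    ∑ p, ∑ q, frobSq (blockSnd M p q) = frobSq M := by
  simp only [frobSq, blockSnd, Matrix.of_apply, Fintype.sum_prod_type]
  rw [Finset.sum_congr rfl fun p _ => Finset.sum_comm, Finset.sum_comm]
  exact Finset.sum_congr rfl fun i _ => Finset.sum_congr rfl fun p _ => Finset.sum_comm

lemma blockFst_kronecker_mul {m n : Type*} [Fintype m] [DecidableEq m] [Fintype n]
    (U : Matrix n n ℂ) (Z : Matrix (m × n) (m × n) ℂ) (i j : m) :
    blockFst (((1 : Matrix m m ℂ) ⊗ₖ U) * Z * ((1 : Matrix m m ℂ) ⊗ₖ U)ᴴ) i j =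
      U * blockFst Z i j * Uᴴ := by
  ext p q
  simp [blockFst, Matrix.mul_apply, Fintype.sum_prod_type, Matrix.one_apply,
    apply_ite (starRingEnd ℂ)]

lemma blockSnd_kronecker_mul {m n : Type*} [Fintype m] [DecidableEq n] [Fintype n]
    (U : Matrix m m ℂ) (Z : Matrix (m × n) (m × n) ℂ) (p q : n) :
    blockSnd ((U ⊗ₖ (1 : Matrix n n ℂ)) * Z * (U ⊗ₖ (1 : Matrix n n ℂ))ᴴ) p q =
      U * blockSnd Z p q * Uᴴ := by
  ext i j
  simp [blockSnd, Matrix.mul_apply, Fintype.sum_prod_type, Matrix.one_apply,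
    apply_ite (starRingEnd ℂ)]

lemma trace_mul_eq_sum_blockFst {m n : Type*} [Fintype m] [Fintype n]
    (X Z : Matrix (m × n) (m × n) ℂ) :
    (X * Z).trace = ∑ s : m × m, (blockFst X s.1 s.2 * blockFst Z s.2 s.1).trace := by
  simp only [Matrix.trace, Matrix.diag, Matrix.mul_apply, blockFst, Matrix.of_apply,
    Fintype.sum_prod_type]
  exact Finset.sum_congr rfl fun i _ => Finset.sum_comm

/-- The projection onto the part that is traceless on the second factor. -/
def centerBlocks {m : Type*} (X : Matrix (m × n) (m × n) ℂ) : Matrix (m × n) (m × n) ℂ :=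
  Matrix.of fun s t => center n (blockFst X s.1 t.1) s.2 t.2

lemma frobSq_centerBlocks_le {m : Type*} [Fintype m] [Nonempty n] (X : Matrix (m × n) (m × n) ℂ) :
    frobSq (centerBlocks X) ≤ frobSq X := by
  rw [← sum_frobSq_blockFst, ← sum_frobSq_blockFst X]
  gcongr with i _ j _
  exact frobSq_center_le _

/-- The unitary on `n` is averaged first, on blocks indexed by `m × m`. Each term of the result is
again a squared trace pairing, now on `m`, so the one-unitary bound applies to the other average. -/
lemma integral_sq_norm_trace_kronecker_le [Nontrivial m] [Nontrivial n]
    (X Y : Matrix (m × n) (m × n) ℂ) (h₁ : ∀ p q, (blockSnd Y p q).trace = 0)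
    (h₂ : ∀ i j, (blockFst Y i j).trace = 0) :
    ∫ U, ‖(X * (((U.1 : Matrix m m ℂ) ⊗ₖ (U.2 : Matrix n n ℂ)) * Y *
        ((U.1 : Matrix m m ℂ) ⊗ₖ (U.2 : Matrix n n ℂ))ᴴ)).trace‖ ^ 2
        ∂((unitaryHaar m).prod (unitaryHaar n)) ≤
      ((Fintype.card m : ℝ) ^ 2 - 1)⁻¹ * ((Fintype.card n : ℝ) ^ 2 - 1)⁻¹ *
        (frobSq X * frobSq Y) := by
  have hm := card_sq_sub_one_pos (n := m)
  have hn := card_sq_sub_one_pos (n := n)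
  have hc : Continuous fun U : Matrix.unitaryGroup m ℂ × Matrix.unitaryGroup n ℂ =>
      (U.1 : Matrix m m ℂ) ⊗ₖ (U.2 : Matrix n n ℂ) :=
    continuous_kronecker (continuous_subtype_val.comp continuous_fst)
      (continuous_subtype_val.comp continuous_snd)
  rw [integral_prod _ (integrable_of_continuous _
    (continuous_sq_norm_trace hc X Y))]
  set Y' : Matrix.unitaryGroup m ℂ → Matrix (m × n) (m × n) ℂ := fun U =>
    ((U : Matrix m m ℂ) ⊗ₖ (1 : Matrix n n ℂ)) * Y * ((U : Matrix m m ℂ) ⊗ₖ (1 : Matrix n n ℂ))ᴴ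
    with hY'
  have hsplit : ∀ (U : Matrix.unitaryGroup m ℂ) (W : Matrix.unitaryGroup n ℂ),
      (X * (((U : Matrix m m ℂ) ⊗ₖ (W : Matrix n n ℂ)) * Y *
        ((U : Matrix m m ℂ) ⊗ₖ (W : Matrix n n ℂ))ᴴ)).trace =
      ∑ s : m × m, (blockFst X s.1 s.2 *
        ((W : Matrix n n ℂ) * blockFst (Y' U) s.2 s.1 * (W : Matrix n n ℂ)ᴴ)).trace := by
    intro U W
    simp only [← blockFst_kronecker_mul, ← trace_mul_eq_sum_blockFst, hY']
    have : (U : Matrix m m ℂ) ⊗ₖ (W : Matrix n n ℂ) =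
        ((1 : Matrix m m ℂ) ⊗ₖ (W : Matrix n n ℂ)) *
          ((U : Matrix m m ℂ) ⊗ₖ (1 : Matrix n n ℂ)) := by
      rw [← Matrix.mul_kronecker_mul, one_mul, mul_one]
    rw [this, Matrix.conjTranspose_mul]
    simp only [mul_assoc]
  -- The partial trace over `n` commutes with conjugation by a unitary on `m` and already
  -- annihilates `Y`.
  have htr : ∀ (U : Matrix.unitaryGroup m ℂ) (s : m × m),
      (blockFst (Y' U) s.2 s.1).trace = 0 := by
    intro U s
    have e : (blockFst (Y' U) s.2 s.1).trace = ∑ p, blockSnd (Y' U) p p s.2 s.1 := rfl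
    rw [e]
    simp only [hY', blockSnd_kronecker_mul, ← Matrix.sum_apply, ← Finset.sum_mul,
      ← Finset.mul_sum]
    have : ∑ p, blockSnd Y p p = 0 := by
      ext i j
      rw [Matrix.sum_apply]
      exact h₂ i j
    simp [this]
  simp only [hsplit]
  have hinner := fun U : Matrix.unitaryGroup m ℂ => integral_sq_norm_sum_trace
    (fun s : m × m => blockFst X s.1 s.2) (fun s => blockFst (Y' U) s.2 s.1) (htr U)
  simp only [hinner]
  -- Exchange of roles: for fixed indices in `n`, the sum over pairs of indices in `m` is itself a
  -- trace over `m`.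
  have hre : ∀ (U : Matrix.unitaryGroup m ℂ) (s t : n × n),
      ∑ i : m × m, center n (blockFst X i.1 i.2) s.1 s.2 * blockFst (Y' U) i.2 i.1 t.1 t.2 =
      (blockSnd (centerBlocks X) s.1 s.2 *
        ((U : Matrix m m ℂ) * blockSnd Y t.1 t.2 * (U : Matrix m m ℂ)ᴴ)).trace := by
    intro U s t
    rw [← blockSnd_kronecker_mul]
    simp only [Matrix.trace, Matrix.diag, Matrix.mul_apply, Fintype.sum_prod_type]
    rfl
  simp only [hre]
  have hint : ∀ s t : n × n, Integrable (fun U : Matrix.unitaryGroup m ℂ =>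
      ‖(blockSnd (centerBlocks X) s.1 s.2 *
        ((U : Matrix m m ℂ) * blockSnd Y t.1 t.2 * (U : Matrix m m ℂ)ᴴ)).trace‖ ^ 2)
        (unitaryHaar m) := fun s t => integrable_of_continuous _
    (continuous_sq_norm_trace continuous_subtype_val _ _)
  rw [integral_const_mul, integral_finsetSum _ fun s _ => integrable_finsetSum _ fun t _ =>
    hint s t]
  simp only [integral_finsetSum _ fun t _ => hint _ t]
  calc _ ≤ ((Fintype.card n : ℝ) ^ 2 - 1)⁻¹ * ∑ s : n × n, ∑ t : n × n,
        ((Fintype.card m : ℝ) ^ 2 - 1)⁻¹ *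
          (frobSq (blockSnd (centerBlocks X) s.1 s.2) * frobSq (blockSnd Y t.1 t.2)) := by
        gcongr with s _ t _
        exact integral_sq_norm_trace_le _ _ (h₁ _ _)
    _ = ((Fintype.card m : ℝ) ^ 2 - 1)⁻¹ * ((Fintype.card n : ℝ) ^ 2 - 1)⁻¹ *
        (frobSq (centerBlocks X) * frobSq Y) := by
        simp only [← Finset.mul_sum, ← Finset.sum_mul, Fintype.sum_prod_type, sum_frobSq_blockSnd]
        ring
    _ ≤ _ := by
        have := frobSq_centerBlocks_le X
        have := frobSq_nonneg Y
        gcongr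

end Pair

/-! ### Ampliations and completely positive maps -/

section Ampliation

variable {A B C R : Type*}

lemma ampliate_apply (T : Matrix A A ℂ →ₗ[ℂ] Matrix B B ℂ) (M : Matrix (A × R) (A × R) ℂ)
    (p q : B × R) : ampliate R T M p q = T (blockSnd M p.2 q.2) p.1 q.1 := rfl

lemma blockSnd_ampliate (T : Matrix A A ℂ →ₗ[ℂ] Matrix B B ℂ) (M : Matrix (A × R) (A × R) ℂ)
    (r s : R) : blockSnd (ampliate R T M) r s = T (blockSnd M r s) := rfl

lemma ampliate_comp (S : Matrix B B ℂ →ₗ[ℂ] Matrix C C ℂ) (T : Matrix A A ℂ →ₗ[ℂ] Matrix B B ℂ)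
    (M : Matrix (A × R) (A × R) ℂ) :
    ampliate R (S ∘ₗ T) M = ampliate R S (ampliate R T M) := rfl

lemma ampliate_add (T : Matrix A A ℂ →ₗ[ℂ] Matrix B B ℂ) (M N : Matrix (A × R) (A × R) ℂ) :
    ampliate R T (M + N) = ampliate R T M + ampliate R T N := by
  ext p q
  have : blockSnd (M + N) p.2 q.2 = blockSnd M p.2 q.2 + blockSnd N p.2 q.2 := rfl
  simp [ampliate_apply, this]

lemma ampliate_sub (T : Matrix A A ℂ →ₗ[ℂ] Matrix B B ℂ) (M N : Matrix (A × R) (A × R) ℂ) :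
    ampliate R T (M - N) = ampliate R T M - ampliate R T N := by
  ext p q
  have : blockSnd (M - N) p.2 q.2 = blockSnd M p.2 q.2 - blockSnd N p.2 q.2 := rfl
  simp [ampliate_apply, this]

lemma ampliate_add_left (S T : Matrix A A ℂ →ₗ[ℂ] Matrix B B ℂ) (M : Matrix (A × R) (A × R) ℂ) :
    ampliate R (S + T) M = ampliate R S M + ampliate R T M := rfl

lemma ampliate_sub_left (S T : Matrix A A ℂ →ₗ[ℂ] Matrix B B ℂ) (M : Matrix (A × R) (A × R) ℂ) :
    ampliate R (S - T) M = ampliate R S M - ampliate R T M := rfl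

/-- The marginal on the first factor. -/
def traceRight [Fintype R] (M : Matrix (A × R) (A × R) ℂ) : Matrix A A ℂ :=
  ∑ r, blockSnd M r r

lemma traceRight_ampliate [Fintype R] (T : Matrix A A ℂ →ₗ[ℂ] Matrix B B ℂ)
    (M : Matrix (A × R) (A × R) ℂ) : traceRight (ampliate R T M) = T (traceRight M) := by
  simp only [traceRight, blockSnd_ampliate, map_sum]

lemma trace_traceRight [Fintype A] [Fintype R] (M : Matrix (A × R) (A × R) ℂ) :
    (traceRight M).trace = M.trace := by
  simp only [traceRight, Matrix.trace, Matrix.diag, Matrix.sum_apply, Fintype.sum_prod_type]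
  rfl

/-- The definition only tests ancillas `Fin k`; enumerating `R` transports it to an arbitrary finite
type. -/
lemma IsCompletelyPositive.posSemidef_ampliate [Fintype R]
    {T : Matrix A A ℂ →ₗ[ℂ] Matrix B B ℂ} (hT : IsCompletelyPositive T)
    {M : Matrix (A × R) (A × R) ℂ} (hM : M.PosSemidef) : (ampliate R T M).PosSemidef := by
  classical
  let e := Fintype.equivFin R
  have h := (hT _ _ (hM.submatrix (Prod.map id e.symm))).submatrix (Prod.map id e)
  convert h using 1
  ext p q
  refine congrFun₂ (congrArg T ?_) p.1 q.1
  ext a b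
  simp

lemma IsCompletelyPositive.isHermitian_ampliate [Fintype A] [Fintype R]
    {T : Matrix A A ℂ →ₗ[ℂ] Matrix B B ℂ} (hT : IsCompletelyPositive T)
    {M : Matrix (A × R) (A × R) ℂ} (hM : M.IsHermitian) : (ampliate R T M).IsHermitian := by
  classical
  obtain ⟨P, N, hP, hN, rfl, -⟩ := exists_sub_posSemidef hM
  rw [ampliate_sub]
  exact (hT.posSemidef_ampliate hP).isHermitian.sub (hT.posSemidef_ampliate hN).isHermitian

lemma IsCompletelyPositive.id : IsCompletelyPositive (LinearMap.id (R := ℂ) (M := Matrix A A ℂ)) :=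
  fun _ _ hM => hM

lemma IsCompletelyPositive.add {S T : Matrix A A ℂ →ₗ[ℂ] Matrix B B ℂ}
    (hS : IsCompletelyPositive S) (hT : IsCompletelyPositive T) : IsCompletelyPositive (S + T) :=
  fun k M hM => (hS k M hM).add (hT k M hM)

lemma IsCompletelyPositive.comp {S : Matrix B B ℂ →ₗ[ℂ] Matrix C C ℂ}
    {T : Matrix A A ℂ →ₗ[ℂ] Matrix B B ℂ} (hS : IsCompletelyPositive S)
    (hT : IsCompletelyPositive T) : IsCompletelyPositive (S ∘ₗ T) :=
  fun k M hM => hS k _ (hT k M hM)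

/-- Conjugation by a matrix. -/
def conjMap [Fintype A] (V : Matrix A A ℂ) : Matrix A A ℂ →ₗ[ℂ] Matrix A A ℂ where
  toFun Z := V * Z * Vᴴ
  map_add' _ _ := by rw [mul_add, add_mul]
  map_smul' _ _ := by simp

lemma conjMap_apply [Fintype A] (V Z : Matrix A A ℂ) : conjMap V Z = V * Z * Vᴴ := rfl

lemma ampliate_conjMap [Fintype A] [Fintype R] [DecidableEq R] (V : Matrix A A ℂ)
    (M : Matrix (A × R) (A × R) ℂ) :
    ampliate R (conjMap V) M =
      (V ⊗ₖ (1 : Matrix R R ℂ)) * M * (V ⊗ₖ (1 : Matrix R R ℂ))ᴴ := by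
  ext p q
  rw [ampliate_apply, conjMap_apply, ← blockSnd_kronecker_mul]
  rfl

lemma IsCompletelyPositive.conjMap [Fintype A] (V : Matrix A A ℂ) :
    IsCompletelyPositive (conjMap V) := by
  intro k M hM
  rw [ampliate_conjMap]
  exact hM.mul_mul_conjTranspose_same _

lemma blockSnd_one_kronecker_mul [Fintype A] [DecidableEq A] [Fintype R] (Q : Matrix R R ℂ)
    (M : Matrix (A × R) (A × R) ℂ) (r s : R) :
    blockSnd (((1 : Matrix A A ℂ) ⊗ₖ Q) * M * ((1 : Matrix A A ℂ) ⊗ₖ Q)ᴴ) r s =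
      ∑ u, ∑ v, (Q r v * star (Q s u)) • blockSnd M v u := by
  ext a b
  change blockFst _ a b r s = _
  rw [blockFst_kronecker_mul]
  simp only [Matrix.mul_apply, Matrix.sum_apply, Finset.sum_mul, Matrix.smul_apply, smul_eq_mul,
    Matrix.conjTranspose_apply]
  refine Finset.sum_congr rfl fun u _ => Finset.sum_congr rfl fun v _ => ?_
  simp only [blockFst, blockSnd, Matrix.of_apply]
  ring

/-- Acting on `R` only forms linear combinations of the `R`-blocks, and `T` is linear on blocks.
This moves weights on `R` outside the superoperator. -/
lemma ampliate_one_kronecker_mul [Fintype A] [DecidableEq A] [Fintype B] [DecidableEq B]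
    [Fintype R] (T : Matrix A A ℂ →ₗ[ℂ] Matrix B B ℂ) (Q : Matrix R R ℂ)
    (M : Matrix (A × R) (A × R) ℂ) :
    ampliate R T (((1 : Matrix A A ℂ) ⊗ₖ Q) * M * ((1 : Matrix A A ℂ) ⊗ₖ Q)ᴴ) =
      ((1 : Matrix B B ℂ) ⊗ₖ Q) * ampliate R T M * ((1 : Matrix B B ℂ) ⊗ₖ Q)ᴴ := by
  ext p q
  rw [ampliate_apply, blockSnd_one_kronecker_mul]
  refine Eq.trans ?_ (congrFun₂ (blockSnd_one_kronecker_mul Q (ampliate R T M) p.2 q.2)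
    p.1 q.1).symm
  simp only [map_sum, map_smul, blockSnd_ampliate]

end Ampliation

/-! ### The bilinear pairing of a Choi matrix with a state -/

section Contract

variable {A B R : Type*} [Fintype A]

/-- The output `|A| ∑ X_{aa'} ⊗ Y_{aa'}` of the superoperator with Choi matrix `X` applied to `Y`. -/
def contract (X : Matrix (A × B) (A × B) ℂ) (Y : Matrix (A × R) (A × R) ℂ) :
    Matrix (B × R) (B × R) ℂ :=
  (Fintype.card A : ℂ) • ∑ a, ∑ a', blockFst X a a' ⊗ₖ blockFst Y a a'

lemma contract_apply (X : Matrix (A × B) (A × B) ℂ) (Y : Matrix (A × R) (A × R) ℂ)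
    (p q : B × R) : contract X Y p q =
      Fintype.card A * ∑ a, ∑ a', X (a, p.1) (a', q.1) * Y (a, p.2) (a', q.2) := by
  simp [contract, Matrix.sum_apply, blockFst]

lemma contract_add_right (X : Matrix (A × B) (A × B) ℂ) (Y Y' : Matrix (A × R) (A × R) ℂ) :
    contract X (Y + Y') = contract X Y + contract X Y' := by
  ext p q
  simp [contract_apply, mul_add, Finset.sum_add_distrib]

lemma contract_sub_right (X : Matrix (A × B) (A × B) ℂ) (Y Y' : Matrix (A × R) (A × R) ℂ) :
    contract X (Y - Y') = contract X Y - contract X Y' := by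
  ext p q
  simp [contract_apply, mul_sub, Finset.sum_sub_distrib]

lemma contract_add_left (X X' : Matrix (A × B) (A × B) ℂ) (Y : Matrix (A × R) (A × R) ℂ) :
    contract (X + X') Y = contract X Y + contract X' Y := by
  ext p q
  simp [contract_apply, mul_add, add_mul, Finset.sum_add_distrib]

lemma contract_sub_left (X X' : Matrix (A × B) (A × B) ℂ) (Y : Matrix (A × R) (A × R) ℂ) :
    contract (X - X') Y = contract X Y - contract X' Y := by
  ext p q
  simp [contract_apply, mul_sub, sub_mul, Finset.sum_sub_distrib]

lemma isHermitian_contract {X : Matrix (A × B) (A × B) ℂ} {Y : Matrix (A × R) (A × R) ℂ}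
    (hX : X.IsHermitian) (hY : Y.IsHermitian) : (contract X Y).IsHermitian := by
  ext p q
  rw [Matrix.conjTranspose_apply, contract_apply, contract_apply, Finset.sum_comm]
  simp only [star_mul', star_sum, hX.apply, hY.apply, star_natCast]

/-- Up to the factor `|A|`, the pairing compresses `X ⊗ Y` by the unnormalised maximally entangled
vector on the two copies of `A`; the matrix `E` is that vector tensored with identities. -/
lemma posSemidef_contract [Fintype B] [Fintype R] {X : Matrix (A × B) (A × B) ℂ}
    {Y : Matrix (A × R) (A × R) ℂ}
    (hX : X.PosSemidef) (hY : Y.PosSemidef) : (contract X Y).PosSemidef := by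
  classical
  let E : Matrix ((A × B) × (A × R)) (B × R) ℂ := Matrix.of fun p q =>
    if p.1.1 = p.2.1 then if p.1.2 = q.1 then if p.2.2 = q.2 then 1 else 0 else 0 else 0
  have h : contract X Y = (Fintype.card A : ℂ) • (Eᴴ * (X ⊗ₖ Y) * E) := by
    ext p q
    rw [contract_apply, Finset.sum_comm]
    simp [E, Matrix.mul_apply, Fintype.sum_prod_type, apply_ite (starRingEnd ℂ)]
  rw [h]
  exact ((hX.kronecker hY).conjTranspose_mul_mul_same E).smul (Nat.cast_nonneg _)

lemma trace_contract [Fintype B] [Fintype R] (X : Matrix (A × B) (A × B) ℂ)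
    (Y : Matrix (A × R) (A × R) ℂ) : (contract X Y).trace =
      Fintype.card A * ∑ a, ∑ a', traceRight X a a' * traceRight Y a a' := by
  simp only [contract, Matrix.trace_smul, Matrix.trace_sum, Matrix.trace_kronecker, smul_eq_mul]
  simp [Matrix.trace, traceRight, Matrix.sum_apply, blockFst, blockSnd]

lemma contract_conj [DecidableEq A] [Fintype B] [Fintype R] (X : Matrix (A × B) (A × B) ℂ)
    (Y : Matrix (A × R) (A × R) ℂ) (Q : Matrix B B ℂ) (Q' : Matrix R R ℂ) :
    contract (((1 : Matrix A A ℂ) ⊗ₖ Q) * X * ((1 : Matrix A A ℂ) ⊗ₖ Q)ᴴ)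
      (((1 : Matrix A A ℂ) ⊗ₖ Q') * Y * ((1 : Matrix A A ℂ) ⊗ₖ Q')ᴴ) =
      (Q ⊗ₖ Q') * contract X Y * (Q ⊗ₖ Q')ᴴ := by
  rw [Matrix.conjTranspose_kronecker Q Q']
  simp only [contract, blockFst_kronecker_mul, Matrix.mul_kronecker_mul, Finset.mul_sum,
    Finset.sum_mul, Matrix.mul_smul, Matrix.smul_mul]

/-- This puts every entry in the form of a trace pairing, to which the Haar second moments apply. -/
lemma contract_apply_eq_trace (X : Matrix (A × B) (A × B) ℂ) (Y : Matrix (A × R) (A × R) ℂ)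
    (p q : B × R) : contract X Y p q =
      Fintype.card A * ((blockSnd X p.1 q.1)ᵀ * blockSnd Y p.2 q.2).trace := by
  rw [contract_apply, Finset.sum_comm]
  simp [Matrix.trace, Matrix.mul_apply, blockSnd]

lemma frobSq_contract [Fintype B] [Fintype R] (X : Matrix (A × B) (A × B) ℂ)
    (Y : Matrix (A × R) (A × R) ℂ) : frobSq (contract X Y) =
      (Fintype.card A : ℝ) ^ 2 * ∑ s : B × B, ∑ t : R × R,
        ‖((blockSnd X s.1 s.2)ᵀ * blockSnd Y t.1 t.2).trace‖ ^ 2 := by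
  simp only [frobSq, contract_apply_eq_trace, norm_mul, mul_pow, Fintype.sum_prod_type,
    Complex.norm_natCast, Finset.mul_sum]
  exact Finset.sum_congr rfl fun b _ => Finset.sum_comm

lemma continuous_contract {Ω : Type*} [TopologicalSpace Ω] (X : Matrix (A × B) (A × B) ℂ)
    {Y : Ω → Matrix (A × R) (A × R) ℂ} (hY : Continuous Y) :
    Continuous fun ω => contract X (Y ω) := by
  refine continuous_matrix fun p q => ?_
  simp only [contract_apply]
  have := fun i j => hY.matrix_elem i j
  fun_prop

end Contract

/-! ### Continuity and Frobenius norm auxiliaries -/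

section Auxiliary

lemma continuous_ampliate_conjMap {Ω A R : Type*} [TopologicalSpace Ω] [Fintype A]
    {V : Ω → Matrix A A ℂ} (hV : Continuous V) (T : Matrix A A ℂ →ₗ[ℂ] Matrix A A ℂ)
    (Y : Matrix (A × R) (A × R) ℂ) :
    Continuous fun ω => ampliate R (conjMap (V ω) ∘ₗ T) Y :=
  continuous_matrix fun p q =>
    continuous_conj_entry hV (T (blockSnd Y p.2 q.2)) p.1 q.1

lemma frobSq_transpose {A : Type*} [Fintype A] (M : Matrix A A ℂ) : frobSq Mᵀ = frobSq M := by
  simp only [frobSq, Matrix.transpose_apply]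
  exact Finset.sum_comm

lemma sq_schattenNorm_two_eq_frobSq {A : Type*} [Fintype A] [DecidableEq A] (M : Matrix A A ℂ) : schattenNorm 2 M ^ 2 = frobSq M :=
  sq_schattenNorm_two M

lemma continuous_schattenNorm_two {Ω A : Type*} [TopologicalSpace Ω] [Fintype A]
    [DecidableEq A] {f : Ω → Matrix A A ℂ} (hf : Continuous f) :
    Continuous fun ω => schattenNorm 2 (f ω) := by
  simp only [schattenNorm_two]
  have := fun i j => hf.matrix_elem i j
  fun_prop

end Auxiliary

/-! ### Abstract decoupling families and their two mean estimates -/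

section Family

set_option linter.unusedSectionVars false

variable {Ω : Type*} [TopologicalSpace Ω] [CompactSpace Ω] [MeasurableSpace Ω]
  [OpensMeasurableSpace Ω] {μ : Measure Ω} [IsProbabilityMeasure μ]
  {A B R : Type*} [Fintype A] [DecidableEq A] [Fintype B] [DecidableEq B] [Fintype R]
  [DecidableEq R]

/-- A random family `V` of matrices together with a projection `P` such that the twirl by `V` is
completely depolarising and conjugation by `V` contracts the range of `P` by `κ / |A|` in mean
square; `P` is a difference of completely positive maps that together scale the trace by `c`. -/
structure IsDecouplingFamily (μ : Measure Ω) (V : Ω → Matrix A A ℂ)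
    (P L L' : Matrix A A ℂ →ₗ[ℂ] Matrix A A ℂ) (c κ : ℝ) : Prop where
  continuous : Continuous V
  twirl : ∀ (Z : Matrix A A ℂ) (i j : A), ∫ ω, (V ω * Z * (V ω)ᴴ) i j ∂μ =
    if i = j then Z.trace / Fintype.card A else 0
  second_moment : ∀ X Y : Matrix A A ℂ, ∫ ω, ‖(X * (V ω * P Y * (V ω)ᴴ)).trace‖ ^ 2 ∂μ ≤
    (κ / Fintype.card A) ^ 2 * (frobSq X * frobSq Y)
  eq_sub : P = L - L'
  cp_left : IsCompletelyPositive L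
  cp_right : IsCompletelyPositive L'
  trace_add : ∀ Z, ((L + L') Z).trace = c * Z.trace
  scale_nonneg : 0 ≤ c
  factor_nonneg : 0 ≤ κ

variable {V : Ω → Matrix A A ℂ} {P L L' : Matrix A A ℂ →ₗ[ℂ] Matrix A A ℂ} {c κ : ℝ}

lemma IsDecouplingFamily.isHermitian (h : IsDecouplingFamily μ V P L L' c κ)
    {X : Matrix (A × B) (A × B) ℂ} {Y : Matrix (A × R) (A × R) ℂ} (hX : X.IsHermitian)
    (hY : Y.IsHermitian) (ω : Ω) :
    (contract X (ampliate R (conjMap (V ω) ∘ₗ P) Y)).IsHermitian := by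
  refine isHermitian_contract hX ?_
  rw [ampliate_comp, h.eq_sub, ampliate_sub_left]
  exact (IsCompletelyPositive.conjMap _).isHermitian_ampliate
    ((h.cp_left.isHermitian_ampliate hY).sub (h.cp_right.isHermitian_ampliate hY))

/-- Only the marginals on `A` enter the trace, and the twirl makes that of `Y` maximally mixed;
hence no condition on the `A`-marginal of `X` is needed. -/
lemma IsDecouplingFamily.integral_trace (h : IsDecouplingFamily μ V P L L' c κ)
    (T : Matrix A A ℂ →ₗ[ℂ] Matrix A A ℂ) [Nonempty A]
    (X : Matrix (A × B) (A × B) ℂ) (Y : Matrix (A × R) (A × R) ℂ) :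
    ∫ ω, (contract X (ampliate R (conjMap (V ω) ∘ₗ T) Y)).trace ∂μ =
      X.trace * (T (traceRight Y)).trace := by
  simp only [trace_contract, traceRight_ampliate, LinearMap.comp_apply, conjMap_apply]
  have hint : ∀ a a', Integrable (fun ω => traceRight X a a' *
      (V ω * T (traceRight Y) * (V ω)ᴴ) a a') μ := fun a a' =>
    (integrable_of_continuous _ (continuous_conj_entry h.continuous _ a a')).const_mul _
  rw [integral_const_mul, integral_finsetSum _ fun a _ => integrable_finsetSum _ fun a' _ =>
    hint a a']
  simp only [integral_finsetSum _ fun a' _ => hint _ a', integral_const_mul, h.twirl]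
  simp only [mul_ite, mul_zero, Finset.sum_ite_eq, Finset.mem_univ, if_true, ← Finset.sum_mul]
  have hd : (Fintype.card A : ℂ) ≠ 0 := by simp
  rw [← trace_traceRight X]
  simp only [Matrix.trace, Matrix.diag]
  field_simp

/-- Splitting `X`, `Y` and `P` into differences gives eight positive terms with signs. The trace
norm is at most the sum of their traces, which is the trace of the same expression with every minus
sign made plus. -/
lemma IsDecouplingFamily.lintegral_le_first [Nonempty A]
    (h : IsDecouplingFamily μ V P L L' c κ)
    {X : Matrix (A × B) (A × B) ℂ} {Y : Matrix (A × R) (A × R) ℂ} (hX : X.IsHermitian)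
    (hY : Y.IsHermitian) :
    ∫⁻ ω, ENNReal.ofReal (schattenNorm 1 (contract X (ampliate R (conjMap (V ω) ∘ₗ P) Y))) ∂μ ≤
      ENNReal.ofReal (c * (schattenNorm 1 X * schattenNorm 1 Y)) := by
  obtain ⟨X₁, X₂, hX₁, hX₂, rfl, hXn⟩ := exists_sub_posSemidef hX
  obtain ⟨Y₁, Y₂, hY₁, hY₂, rfl, hYn⟩ := exists_sub_posSemidef hY
  set g : Ω → ℂ := fun ω =>
    (contract (X₁ + X₂) (ampliate R (conjMap (V ω) ∘ₗ (L + L')) (Y₁ + Y₂))).trace with hg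
  have hgc : Continuous g :=
    (continuous_contract _ (continuous_ampliate_conjMap h.continuous _ _)).matrix_trace
  have hgi := integrable_of_continuous μ hgc
  have hpos : ∀ {T : Matrix A A ℂ →ₗ[ℂ] Matrix A A ℂ}, IsCompletelyPositive T →
      ∀ {X : Matrix (A × B) (A × B) ℂ} {Y : Matrix (A × R) (A × R) ℂ}, X.PosSemidef →
      Y.PosSemidef → ∀ ω, (contract X (ampliate R (conjMap (V ω) ∘ₗ T) Y)).PosSemidef :=
    fun hT _ _ hX hY ω => posSemidef_contract hX
      (((IsCompletelyPositive.conjMap _).comp hT).posSemidef_ampliate hY)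
  have hle : ∀ ω, schattenNorm 1 (contract (X₁ - X₂) (ampliate R (conjMap (V ω) ∘ₗ P) (Y₁ - Y₂)))
      ≤ (g ω).re := by
    intro ω
    set f := fun (T : Matrix A A ℂ →ₗ[ℂ] Matrix A A ℂ) (X : Matrix (A × B) (A × B) ℂ)
      (Y : Matrix (A × R) (A × R) ℂ) => contract X (ampliate R (conjMap (V ω) ∘ₗ T) Y) with hf
    have h1 := fun X Y hX hY => hpos h.cp_left (X := X) (Y := Y) hX hY ω
    have h2 := fun X Y hX hY => hpos h.cp_right (X := X) (Y := Y) hX hY ω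
    -- The terms with an even number of minus signs are collected first, the odd ones second.
    have hN := schattenNorm_one_sub_le
      (((h1 X₁ Y₁ hX₁ hY₁).add (h1 X₂ Y₂ hX₂ hY₂)).add
        ((h2 X₁ Y₂ hX₁ hY₂).add (h2 X₂ Y₁ hX₂ hY₁)))
      (((h1 X₁ Y₂ hX₁ hY₂).add (h1 X₂ Y₁ hX₂ hY₁)).add
        ((h2 X₁ Y₁ hX₁ hY₁).add (h2 X₂ Y₂ hX₂ hY₂)))
    refine (le_of_eq ?_).trans (hN.trans (le_of_eq ?_))
    · congr 1
      rw [h.eq_sub, LinearMap.comp_sub]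
      simp only [ampliate_sub_left, ampliate_sub, contract_sub_left, contract_sub_right]
      abel
    · rw [hg]
      congr 2
      rw [LinearMap.comp_add]
      simp only [ampliate_add_left, ampliate_add, contract_add_left, contract_add_right]
      abel
  have hre : ∫ ω, (g ω).re ∂μ = c * (schattenNorm 1 (X₁ - X₂) * schattenNorm 1 (Y₁ - Y₂)) := by
    have e := integral_re (𝕜 := ℂ) hgi
    simp only [RCLike.re_to_complex] at e
    rw [e, h.integral_trace, h.trace_add, trace_traceRight, hXn, hYn]
    have hX' := (Complex.nonneg_iff.mp (hX₁.add hX₂).trace_nonneg).2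
    rw [Complex.mul_re, Complex.re_ofReal_mul, ← hX']
    ring
  calc _ ≤ ∫⁻ ω, ENNReal.ofReal ((g ω).re) ∂μ :=
        lintegral_mono fun ω => ENNReal.ofReal_le_ofReal (hle ω)
    _ = ENNReal.ofReal (∫ ω, (g ω).re ∂μ) :=
        (ofReal_integral_eq_lintegral_ofReal hgi.re (.of_forall fun ω =>
          (schattenNorm_one_nonneg (h.isHermitian (hX₁.isHermitian.sub hX₂.isHermitian)
            (hY₁.isHermitian.sub hY₂.isHermitian) ω)).trans (hle ω))).symm
    _ = _ := by rw [hre]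

/-- Nonnegativity of the variance. -/
lemma sq_integral_le {f : Ω → ℝ} (hf : Continuous f) :
    (∫ ω, f ω ∂μ) ^ 2 ≤ ∫ ω, f ω ^ 2 ∂μ := by
  set m := ∫ ω, f ω ∂μ with hm
  have h : 0 ≤ ∫ ω, (f ω - m) ^ 2 ∂μ := integral_nonneg fun _ => sq_nonneg _
  have hi := integrable_of_continuous μ hf
  have hi2 := integrable_of_continuous μ (f := fun ω => f ω ^ 2) (hf.pow 2)
  have e : ∀ ω, (f ω - m) ^ 2 = f ω ^ 2 - 2 * m * f ω + m ^ 2 := fun ω => by ring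
  simp only [e] at h
  rw [integral_add (f := fun ω => f ω ^ 2 - 2 * m * f ω) (hi2.sub (hi.const_mul _))
      (integrable_const _),
    integral_sub hi2 (hi.const_mul _), integral_const_mul, ← hm] at h
  simp at h
  nlinarith

lemma IsDecouplingFamily.integral_frobSq_le [Nonempty A] (h : IsDecouplingFamily μ V P L L' c κ)
    (X : Matrix (A × B) (A × B) ℂ) (Y : Matrix (A × R) (A × R) ℂ) :
    ∫ ω, frobSq (contract X (ampliate R (conjMap (V ω) ∘ₗ P) Y)) ∂μ ≤
      κ ^ 2 * (frobSq X * frobSq Y) := by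
  simp only [frobSq_contract, blockSnd_ampliate, LinearMap.comp_apply, conjMap_apply]
  have hint : ∀ (s : B × B) (t : R × R), Integrable (fun ω =>
      ‖((blockSnd X s.1 s.2)ᵀ * (V ω * P (blockSnd Y t.1 t.2) * (V ω)ᴴ)).trace‖ ^ 2) μ :=
    fun s t => integrable_of_continuous _ (continuous_sq_norm_trace h.continuous _ _)
  rw [integral_const_mul, integral_finsetSum _ fun s _ => integrable_finsetSum _ fun t _ =>
    hint s t]
  simp only [integral_finsetSum _ fun t _ => hint _ t]
  calc _ ≤ (Fintype.card A : ℝ) ^ 2 * ∑ s : B × B, ∑ t : R × R, (κ / Fintype.card A) ^ 2 *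
        (frobSq (blockSnd X s.1 s.2)ᵀ * frobSq (blockSnd Y t.1 t.2)) := by
        gcongr with s _ t _
        exact h.second_moment _ _
    _ = _ := by
        simp only [frobSq_transpose, ← Finset.mul_sum, ← Finset.sum_mul, Fintype.sum_prod_type,
          sum_frobSq_blockSnd]
        have : (Fintype.card A : ℝ) ≠ 0 := by simp
        field_simp

/-- The weights factor out of the pairing as conjugation by `Q ⊗ Q'`, whose fourth power has trace
at most one; Hölder then leaves the unweighted 2-norm, and Jensen brings in its mean square. -/
lemma IsDecouplingFamily.lintegral_le_second [Nonempty A] (h : IsDecouplingFamily μ V P L L' c κ)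
    {X : Matrix (A × B) (A × B) ℂ} {Y : Matrix (A × R) (A × R) ℂ} (hX : X.IsHermitian)
    (hY : Y.IsHermitian) {Q : Matrix B B ℂ} {Q' : Matrix R R ℂ} (hQ : Q.IsHermitian)
    (hQ' : Q'.IsHermitian) (hQ₁ : (Q * Q * (Q * Q)).PosSemidef)
    (hQ₂ : (Q * Q * (Q * Q)).trace.re ≤ 1) (hQ₁' : (Q' * Q' * (Q' * Q')).PosSemidef)
    (hQ₂' : (Q' * Q' * (Q' * Q')).trace.re ≤ 1) :
    ∫⁻ ω, ENNReal.ofReal (schattenNorm 1 (contract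
        (((1 : Matrix A A ℂ) ⊗ₖ Q) * X * ((1 : Matrix A A ℂ) ⊗ₖ Q)ᴴ)
        (ampliate R (conjMap (V ω) ∘ₗ P)
          (((1 : Matrix A A ℂ) ⊗ₖ Q') * Y * ((1 : Matrix A A ℂ) ⊗ₖ Q')ᴴ)))) ∂μ ≤
      ENNReal.ofReal (κ * (schattenNorm 2 X * schattenNorm 2 Y)) := by
  set F : Ω → Matrix (B × R) (B × R) ℂ :=
    fun ω => contract X (ampliate R (conjMap (V ω) ∘ₗ P) Y) with hF
  have hFc : Continuous F := continuous_contract _ (continuous_ampliate_conjMap h.continuous _ _)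
  have hQQ : (Q ⊗ₖ Q').IsHermitian := by
    rw [Matrix.IsHermitian, Matrix.conjTranspose_kronecker, hQ.eq, hQ'.eq]
  have hle : ∀ ω, schattenNorm 1 (contract
        (((1 : Matrix A A ℂ) ⊗ₖ Q) * X * ((1 : Matrix A A ℂ) ⊗ₖ Q)ᴴ)
        (ampliate R (conjMap (V ω) ∘ₗ P)
          (((1 : Matrix A A ℂ) ⊗ₖ Q') * Y * ((1 : Matrix A A ℂ) ⊗ₖ Q')ᴴ))) ≤
      schattenNorm 2 (F ω) := by
    intro ω
    rw [ampliate_one_kronecker_mul, contract_conj]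
    conv_lhs => rw [hQQ.eq]
    refine (schattenNorm_one_conj_le hQQ (h.isHermitian hX hY ω)).trans ?_
    refine mul_le_of_le_one_left (schattenNorm_two_nonneg _) (Real.sqrt_le_one.mpr ?_)
    rw [← Matrix.mul_kronecker_mul, ← Matrix.mul_kronecker_mul, Matrix.trace_kronecker,
      Complex.mul_re, ← (Complex.nonneg_iff.mp hQ₁.trace_nonneg).2]
    have h1 := re_trace_nonneg hQ₁
    have h2 := re_trace_nonneg hQ₁'
    nlinarith
  have hFn := continuous_schattenNorm_two hFc
  calc _ ≤ ∫⁻ ω, ENNReal.ofReal (schattenNorm 2 (F ω)) ∂μ :=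
        lintegral_mono fun ω => ENNReal.ofReal_le_ofReal (hle ω)
    _ = ENNReal.ofReal (∫ ω, schattenNorm 2 (F ω) ∂μ) :=
        (ofReal_integral_eq_lintegral_ofReal (integrable_of_continuous _ hFn)
          (.of_forall fun ω => schattenNorm_two_nonneg _)).symm
    _ ≤ _ := by
        refine ENNReal.ofReal_le_ofReal ((le_abs_self _).trans (abs_le_of_sq_le_sq ?_ ?_))
        · refine (sq_integral_le hFn).trans ?_
          simp only [sq_schattenNorm_two_eq_frobSq, mul_pow]
          exact h.integral_frobSq_le X Y
        · have := schattenNorm_two_nonneg X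
          have := schattenNorm_two_nonneg Y
          have := h.factor_nonneg
          positivity

end Family

/-! ### Binary exponentials and logarithms on the extended reals -/

section Exponential

lemma log_two_coe_pos : (0 : EReal) < (Real.log 2 : ℝ) := by
  exact_mod_cast Real.log_pos one_lt_two

lemma pow2_mono {x y : EReal} (h : x ≤ y) : pow2 x ≤ pow2 y :=
  EReal.exp_monotone (mul_le_mul_of_nonneg_right h log_two_coe_pos.le)

/-- No finiteness is required: `⊤ + ⊥ = ⊥` in `EReal` agrees with `∞ · 0 = 0` in `ℝ≥0∞`. -/
lemma pow2_add (x y : EReal) : pow2 (x + y) = pow2 x * pow2 y := by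
  rw [pow2, EReal.right_distrib_of_nonneg_of_ne_top log_two_coe_pos.le (EReal.coe_ne_top _),
    EReal.exp_add]
  rfl

lemma half_mul_two_mul (x : EReal) : ((1 / 2 : ℝ) : EReal) * (2 * x) = x := by
  rw [← mul_assoc, show (2 : EReal) = ((2 : ℝ) : EReal) from rfl, ← EReal.coe_mul]
  norm_num

lemma pow2_log2 (c : ℝ≥0∞) : pow2 (log2 c) = c := by
  rw [pow2, log2, EReal.div_mul_cancel (EReal.coe_ne_bot _) (EReal.coe_ne_top _)
    log_two_coe_pos.ne', ENNReal.exp_log]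

lemma log2_mono {c d : ℝ≥0∞} (h : c ≤ d) : log2 c ≤ log2 d :=
  EReal.div_le_div_right_of_nonneg log_two_coe_pos.le (ENNReal.log_monotone h)

lemma le_pow2_half_mul {c : ℝ≥0∞} {x : EReal} (h : 2 * log2 c ≤ x) :
    c ≤ pow2 (((1 / 2 : ℝ) : EReal) * x) := by
  conv_lhs => rw [← pow2_log2 c, ← half_mul_two_mul (log2 c)]
  exact pow2_mono (mul_le_mul_of_nonneg_left h (by norm_num))

end Exponential

/-! ### Supports, fourth roots and marginals -/

section Support

open scoped MatrixOrder

variable {n m : Type*} [Fintype n] [DecidableEq n] [Fintype m] [DecidableEq m]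

lemma mul_eq_self_of_support_le {M N Q : Matrix n n ℂ} (h : support M ≤ support N)
    (hQ : Q * N = N) : Q * M = M := by
  refine Matrix.ext_of_mulVec_single fun j => ?_
  obtain ⟨w, hw⟩ := h ⟨Pi.single j 1, rfl⟩
  simp only [Matrix.mulVecLin_apply] at hw
  rw [← Matrix.mulVec_mulVec, ← hw, Matrix.mulVec_mulVec, hQ]

/-- The fourth root of a positive semidefinite matrix. -/
def fourthRoot (β : Matrix n n ℂ) : Matrix n n ℂ := cfc (fun x : ℝ => x ^ (1 / 4 : ℝ)) β

lemma isHermitian_fourthRoot (β : Matrix n n ℂ) : (fourthRoot β).IsHermitian :=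
  cfc_isHermitian _ _

lemma isHermitian_invFourthRoot (β : Matrix n n ℂ) : (invFourthRoot β).IsHermitian :=
  cfc_isHermitian _ _

lemma fourthRoot_pow_four {β : Matrix n n ℂ} (hβ : β.PosSemidef) :
    fourthRoot β * fourthRoot β * (fourthRoot β * fourthRoot β) = β := by
  rw [fourthRoot, cfc_mul_cfc, cfc_mul_cfc]
  conv_rhs => rw [← cfc_self hβ.isHermitian]
  refine cfc_congr fun x hx => ?_
  have hx := nonneg_of_mem_spectrum hβ hx
  rw [← Real.rpow_add_of_nonneg hx (by norm_num) (by norm_num),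
    ← Real.rpow_add_of_nonneg hx (by norm_num) (by norm_num)]
  norm_num

lemma fourthRoot_mul_invFourthRoot_mul {β : Matrix n n ℂ} (hβ : β.PosSemidef) :
    fourthRoot β * invFourthRoot β * β = β := by
  nth_rewrite 3 [← cfc_self hβ.isHermitian]
  rw [fourthRoot, invFourthRoot, cfc_mul_cfc, cfc_mul_cfc]
  conv_rhs => rw [← cfc_self hβ.isHermitian]
  refine cfc_congr fun x hx => ?_
  have hx := nonneg_of_mem_spectrum hβ hx
  by_cases h : x = 0
  · simp [h]
  · have hx' : 0 < x := lt_of_le_of_ne hx (Ne.symm h)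
    simp only [h, if_false]
    rw [← Real.rpow_add hx']
    norm_num

/-- `β^(1/4) β^(-1/4)` fixes the range of `β`, so it fixes `M` from the left, and by taking adjoints
from the right. -/
lemma fourthRoot_conj_of_support_le {M β : Matrix n n ℂ} (hβ : β.PosSemidef)
    (hM : M.IsHermitian) (h : support M ≤ support β) :
    M = fourthRoot β * (invFourthRoot β * M * invFourthRoot β) * fourthRoot β := by
  have h1 := mul_eq_self_of_support_le h (fourthRoot_mul_invFourthRoot_mul hβ)
  have h2 := congrArg Matrix.conjTranspose h1
  rw [Matrix.conjTranspose_mul, Matrix.conjTranspose_mul, hM.eq, (isHermitian_fourthRoot β).eq,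
    (isHermitian_invFourthRoot β).eq] at h2
  calc M = fourthRoot β * invFourthRoot β * M := h1.symm
    _ = fourthRoot β * invFourthRoot β * (M * (invFourthRoot β * fourthRoot β)) := by rw [h2]
    _ = _ := by simp only [mul_assoc]

/-- The embedding `M ↦ 1 ⊗ M`. -/
def oneKronecker (m n : Type*) [Fintype n] [DecidableEq n] [Fintype m] [DecidableEq m] :
    Matrix n n ℂ →⋆ₐ[ℝ] Matrix (m × n) (m × n) ℂ where
  toFun M := (1 : Matrix m m ℂ) ⊗ₖ M
  map_one' := Matrix.one_kronecker_one
  map_mul' M N := by rw [← Matrix.mul_kronecker_mul, one_mul]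
  map_zero' := Matrix.kronecker_zero _
  map_add' M N := Matrix.kronecker_add _ _ _
  commutes' r := by
    rw [Algebra.algebraMap_eq_smul_one, Algebra.algebraMap_eq_smul_one, Matrix.kronecker_smul,
      Matrix.one_kronecker_one]
  map_star' M := by
    rw [Matrix.star_eq_conjTranspose, Matrix.star_eq_conjTranspose,
      Matrix.conjTranspose_kronecker, Matrix.conjTranspose_one]

/-- Functional calculus commutes with the star homomorphism `M ↦ 1 ⊗ M`. Thus the weight in the
conditional divergence acts on the conditioning system alone. -/
lemma one_kronecker_fourthRoot {β : Matrix n n ℂ} (hβ : β.IsHermitian) :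
    (1 : Matrix m m ℂ) ⊗ₖ fourthRoot β = fourthRoot ((1 : Matrix m m ℂ) ⊗ₖ β) := by
  have hc : Continuous (oneKronecker m n) := continuous_kronecker continuous_const continuous_id
  have hβ' : IsSelfAdjoint β := hβ
  exact StarAlgHom.map_cfc (oneKronecker m n) _ β (continuousOn_spectrum _ _) hc hβ'
    (hβ'.map (oneKronecker m n))

/-- The range of a Hermitian matrix is the orthogonal complement of its kernel. Here this is
realised with the pseudoinverse `Q` of `N`: the kernel condition gives `M (1 - QN) = 0`, whose
adjoint is `NQM = M`. -/
lemma support_le_of_ker_le {M N : Matrix n n ℂ} (hM : M.IsHermitian) (hN : N.IsHermitian)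
    (h : ∀ v, N *ᵥ v = 0 → M *ᵥ v = 0) : support M ≤ support N := by
  set Q : Matrix n n ℂ := cfc (fun x : ℝ => if x = 0 then 0 else x⁻¹) N with hQ
  have hNQ : N * Q * N = N := by
    rw [show N * Q * N = cfc (fun x : ℝ => x) N * Q * cfc (fun x : ℝ => x) N by rw [cfc_self hN],
      hQ, cfc_mul_cfc, cfc_mul_cfc]
    conv_rhs => rw [← cfc_self hN]
    congr 1
    ext x
    by_cases hx : x = 0 <;> simp [hx]
  have h1 : M * (1 - Q * N) = 0 := by
    refine Matrix.ext_of_mulVec_single fun j => ?_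
    rw [← Matrix.mulVec_mulVec, h _, Matrix.zero_mulVec]
    rw [Matrix.mulVec_mulVec, mul_sub, mul_one, ← mul_assoc, hNQ, sub_self, Matrix.zero_mulVec]
  have h2 : N * Q * M = M := by
    have := congrArg Matrix.conjTranspose h1
    rw [Matrix.conjTranspose_mul, Matrix.conjTranspose_sub, Matrix.conjTranspose_mul,
      hM.eq, hN.eq, (cfc_isHermitian _ _ : Q.IsHermitian).eq, Matrix.conjTranspose_one, sub_mul,
      one_mul, Matrix.conjTranspose_zero, sub_eq_zero] at this
    exact this.symm
  rintro _ ⟨v, rfl⟩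
  refine ⟨Q *ᵥ (M *ᵥ v), ?_⟩
  simp only [Matrix.mulVecLin_apply, Matrix.mulVec_mulVec, ← mul_assoc, h2]

lemma traceLeft_eq_sum {n m : Type*} [Fintype m] (M : Matrix (m × n) (m × n) ℂ) :
    traceLeft M = ∑ x, blockFst M x x := by
  ext i j
  simp [traceLeft, blockFst, Matrix.sum_apply]

lemma trace_traceLeft {n m : Type*} [Fintype n] [Fintype m] (M : Matrix (m × n) (m × n) ℂ) : (traceLeft M).trace = M.trace := by
  simp only [traceLeft, Matrix.trace, Matrix.diag, Matrix.of_apply, Fintype.sum_prod_type]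
  exact Finset.sum_comm

lemma posSemidef_traceLeft {n m : Type*} [Fintype m] {M : Matrix (m × n) (m × n) ℂ} (hM : M.PosSemidef) :
    (traceLeft M).PosSemidef := by
  rw [traceLeft_eq_sum]
  exact Matrix.posSemidef_sum _ fun x _ => hM.submatrix fun i => (x, i)

/-- If `1 ⊗ M^Y` kills `v`, every slice of `v` is killed by the sum of the positive diagonal blocks
of `M`, hence by each block. So `M` has zero expectation on each slice `w x`, and positivity gives
`M (w x) = 0`. -/
lemma support_le_one_kronecker_traceLeft {M : Matrix (m × n) (m × n) ℂ} (hM : M.PosSemidef) :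
    support M ≤ support ((1 : Matrix m m ℂ) ⊗ₖ traceLeft M) := by
  have hN := Matrix.PosSemidef.kronecker (Matrix.PosSemidef.one (n := m) (R := ℂ))
    (posSemidef_traceLeft hM)
  refine support_le_of_ker_le hM.isHermitian hN.isHermitian fun v hv => ?_
  set w : m → m × n → ℂ := fun x p => if p.1 = x then v p else 0 with hw
  have hvw : v = ∑ x, w x := by
    ext p
    simp [hw]
  have hker : ∀ x, traceLeft M *ᵥ (fun i => v (x, i)) = 0 := by
    intro x
    ext i
    have := congrFun hv (x, i)
    simpa [Matrix.mulVec, dotProduct, Fintype.sum_prod_type, Matrix.one_apply] using this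
  have hblock : ∀ x, blockFst M x x *ᵥ (fun i => v (x, i)) = 0 := by
    intro x
    have hx : (blockFst M x x).PosSemidef := hM.submatrix fun i => (x, i)
    refine (hx.dotProduct_mulVec_zero_iff _).mp ?_
    have h0 : ∑ y, star (fun i => v (x, i)) ⬝ᵥ (blockFst M y y *ᵥ fun i => v (x, i)) = 0 := by
      rw [← dotProduct_sum, ← Matrix.sum_mulVec, ← traceLeft_eq_sum, hker, dotProduct_zero]
    exact (Finset.sum_eq_zero_iff_of_nonneg fun y _ =>
      Matrix.PosSemidef.dotProduct_mulVec_nonneg (hM.submatrix fun i => (y, i)) _).mp h0 x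
        (Finset.mem_univ _)
  have hMw : ∀ x, M *ᵥ w x = 0 := by
    intro x
    refine (hM.dotProduct_mulVec_zero_iff _).mp ?_
    have := congrArg (fun u => star (fun i => v (x, i)) ⬝ᵥ u) (hblock x)
    simp only [dotProduct_zero] at this
    rw [← this]
    simp [hw, dotProduct, Matrix.mulVec, Fintype.sum_prod_type, blockFst,
      apply_ite (starRingEnd ℂ)]
    refine (Fintype.sum_eq_single x fun y hy => by simp [hy]).trans ?_
    simp only [if_true]
    exact Finset.sum_congr rfl fun i _ => congrArg _
      ((Fintype.sum_eq_single x fun y hy => by simp [hy]).trans (by simp))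
  rw [hvw, Matrix.mulVec_sum]
  exact Finset.sum_eq_zero fun x _ => hMw x

end Support

/-! ### From candidates to smooth entropies -/

section Smoothing

variable {X Y : Type*} [Fintype X] [DecidableEq X] [Fintype Y] [DecidableEq Y]

/-- The candidates in the smoothing of `ω` that are supported on `1 ⊗ ω^Y`. -/
def SmoothingCandidate (ε : ℝ) (ω : Matrix (X × Y) (X × Y) ℂ) : Type _ :=
  {α : Matrix (X × Y) (X × Y) ℂ // IsSubnormalised α ∧ schattenNorm 1 (α - ω) ≤ ε * ω.trace.re ∧
    support α ≤ support ((1 : Matrix X X ℂ) ⊗ₖ traceLeft ω)}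

/-- The weighted Hilbert-Schmidt norm of a candidate. -/
def candidateNorm (ω α : Matrix (X × Y) (X × Y) ℂ) : ℝ :=
  schattenNorm 2 (invFourthRoot ((1 : Matrix X X ℂ) ⊗ₖ traceLeft ω) * α *
    invFourthRoot ((1 : Matrix X X ℂ) ⊗ₖ traceLeft ω))

lemma nonempty_smoothingCandidate {ε : ℝ} (hε : 0 ≤ ε) {ω : Matrix (X × Y) (X × Y) ℂ}
    (hω : IsSubnormalised ω) : Nonempty (SmoothingCandidate ε ω) := by
  refine ⟨ω, hω, ?_, support_le_one_kronecker_traceLeft hω.1⟩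
  rw [schattenNorm_one_of_posSemidef (by simpa using Matrix.PosSemidef.zero), sub_self]
  simpa using mul_nonneg hε (re_trace_nonneg hω.1)

/-- Candidates with the wrong support have divergence `⊤` and may be discarded. Only this inequality
is needed, so attainment of the minimum plays no role. -/
lemma iInf_candidateNorm_le (ε : ℝ) (ω : Matrix (X × Y) (X × Y) ℂ) :
    ⨅ α : SmoothingCandidate ε ω, ENNReal.ofReal (candidateNorm ω α.1) ≤
      pow2 (-((1 / 2 : ℝ) : EReal) * smoothCondEntropy ε ω) := by
  rw [smoothCondEntropy, neg_mul_neg]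
  refine le_pow2_half_mul (le_iInf fun α => ?_)
  rw [renyiTwoDiv]
  split_ifs with h
  · refine mul_le_mul_of_nonneg_left (log2_mono ?_) (by norm_num)
    exact iInf_le (fun α : SmoothingCandidate ε ω => ENNReal.ofReal (candidateNorm ω α.1))
      ⟨α.1, α.2.1, α.2.2, h⟩
  · exact le_top

/-- The bound holds for every pair of candidates, so the two infima may be taken separately after
moving `C` to the left by truncated subtraction. -/
lemma le_add_mul_pow2 {X' Y' : Type*} [Fintype X'] [DecidableEq X'] [Fintype Y'] [DecidableEq Y']
    {ε : ℝ} (hε : 0 ≤ ε) {ω : Matrix (X × Y) (X × Y) ℂ} {ω' : Matrix (X' × Y') (X' × Y') ℂ}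
    (hω : IsSubnormalised ω) (hω' : IsSubnormalised ω') {L C K : ℝ≥0∞} (hK : K ≠ ⊤)
    (h : ∀ (α : SmoothingCandidate ε ω) (α' : SmoothingCandidate ε ω'), L ≤ C +
      K * (ENNReal.ofReal (candidateNorm ω α.1) * ENNReal.ofReal (candidateNorm ω' α'.1))) :
    L ≤ C + K * pow2 (-((1 / 2 : ℝ) : EReal) * smoothCondEntropy ε ω -
      ((1 / 2 : ℝ) : EReal) * smoothCondEntropy ε ω') := by
  have := nonempty_smoothingCandidate hε hω
  have := nonempty_smoothingCandidate hε hω'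
  rw [sub_eq_add_neg, ← EReal.neg_mul, pow2_add]
  have h1 : L - C ≤ (⨅ α : SmoothingCandidate ε ω, K * ENNReal.ofReal (candidateNorm ω α.1)) *
      ⨅ α' : SmoothingCandidate ε ω', ENNReal.ofReal (candidateNorm ω' α'.1) := by
    refine ENNReal.le_iInf_mul_iInf ?_ ?_ fun α α' => ?_
    -- Each family must contain a finite value, which excludes `0 · ∞` in the product of infima;
    -- this is where the states themselves serve as candidates.
    · exact ⟨Classical.arbitrary _, ENNReal.mul_ne_top hK ENNReal.ofReal_ne_top⟩
    · exact ⟨Classical.arbitrary _, ENNReal.ofReal_ne_top⟩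
    · rw [tsub_le_iff_left, mul_assoc]
      exact h α α'
  rw [← ENNReal.mul_iInf fun hK' => absurd hK' hK, mul_assoc] at h1
  rw [← tsub_le_iff_left]
  refine h1.trans ?_
  gcongr
  · exact iInf_candidateNorm_le ε ω
  · exact iInf_candidateNorm_le ε ω'

end Smoothing

/-! ### Decoupling with smoothing -/

section Smoothed

variable {Ω : Type*} [TopologicalSpace Ω] [CompactSpace Ω] [MeasurableSpace Ω]
  [OpensMeasurableSpace Ω] {μ : Measure Ω} [IsProbabilityMeasure μ]
  {A B R : Type*} [Fintype A] [DecidableEq A] [Fintype B] [DecidableEq B] [Fintype R]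
  [DecidableEq R] {V : Ω → Matrix A A ℂ} {P L L' : Matrix A A ℂ →ₗ[ℂ] Matrix A A ℂ} {c κ : ℝ}

lemma schattenNorm_neg {n : Type*} [Fintype n] [DecidableEq n] (p : ℝ) (M : Matrix n n ℂ) :
    schattenNorm p (-M) = schattenNorm p M := by
  simp [schattenNorm]

lemma schattenNorm_one_sub_sub_le {n : Type*} [Fintype n] [DecidableEq n] {M N K : Matrix n n ℂ}
    (hM : M.IsHermitian) (hN : N.IsHermitian) (hK : K.IsHermitian) :
    schattenNorm 1 (M - N - K) ≤ schattenNorm 1 M + schattenNorm 1 N + schattenNorm 1 K := by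
  have h1 := schattenNorm_one_add_le hM hN.neg
  have h2 := schattenNorm_one_add_le (hM.sub hN) hK.neg
  rw [schattenNorm_neg, ← sub_eq_add_neg] at h1 h2
  linarith

/-- `Q` is the fourth root of the marginal of the reference state `Z`, not of the candidate, so `Tr
Q⁴ = Tr Z ≤ 1`. -/
lemma SmoothingCandidate.exists_eq_conj {A S : Type*} [Fintype A] [DecidableEq A] [Fintype S]
    [DecidableEq S] {Z : Matrix (A × S) (A × S) ℂ} {ε : ℝ} (hZ : IsSubnormalised Z)
    (β : SmoothingCandidate ε Z) : ∃ (Q : Matrix S S ℂ) (M : Matrix (A × S) (A × S) ℂ),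
      Q.IsHermitian ∧ (Q * Q * (Q * Q)).PosSemidef ∧ (Q * Q * (Q * Q)).trace.re ≤ 1 ∧
      M.IsHermitian ∧ β.1 = ((1 : Matrix A A ℂ) ⊗ₖ Q) * M * ((1 : Matrix A A ℂ) ⊗ₖ Q)ᴴ ∧
      candidateNorm Z β.1 = schattenNorm 2 M := by
  have hZ' := posSemidef_traceLeft hZ.1
  have hβ := Matrix.PosSemidef.kronecker (Matrix.PosSemidef.one (n := A) (R := ℂ)) hZ'
  refine ⟨fourthRoot (traceLeft Z), _, isHermitian_fourthRoot _, ?_, ?_, ?_, ?_, rfl⟩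
  · rwa [fourthRoot_pow_four hZ']
  · rw [fourthRoot_pow_four hZ', trace_traceLeft]
    exact hZ.2
  · have hi := isHermitian_invFourthRoot ((1 : Matrix A A ℂ) ⊗ₖ traceLeft Z)
    have := Matrix.isHermitian_mul_mul_conjTranspose
      (invFourthRoot ((1 : Matrix A A ℂ) ⊗ₖ traceLeft Z)) β.2.1.1.isHermitian
    rwa [hi.eq] at this
  · rw [one_kronecker_fourthRoot hZ'.isHermitian, (isHermitian_fourthRoot _).eq]
    exact fourthRoot_conj_of_support_le hβ β.2.1.1.isHermitian β.2.2.2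

/-- The mean trace norm when both arguments are weighted by the marginals of reference states. -/
lemma IsDecouplingFamily.lintegral_le_candidate [Nonempty A]
    (h : IsDecouplingFamily μ V P L L' c κ) {X : Matrix (A × B) (A × B) ℂ}
    {Y : Matrix (A × R) (A × R) ℂ} (hX : IsSubnormalised X) (hY : IsSubnormalised Y) {ε : ℝ}
    (α : SmoothingCandidate ε Y) (α' : SmoothingCandidate ε X) :
    ∫⁻ ω, ENNReal.ofReal (schattenNorm 1
      (contract α'.1 (ampliate R (conjMap (V ω) ∘ₗ P) α.1))) ∂μ ≤
      ENNReal.ofReal (κ * (candidateNorm X α'.1 * candidateNorm Y α.1)) := by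
  obtain ⟨Q, M, hQ, hQ₁, hQ₂, hM, e, hn⟩ := α'.exists_eq_conj hX
  obtain ⟨Q', M', hQ', hQ₁', hQ₂', hM', e', hn'⟩ := α.exists_eq_conj hY
  rw [hn, hn', e, e']
  exact h.lintegral_le_second hM hM' hQ hQ' hQ₁ hQ₂ hQ₁' hQ₂'

lemma IsDecouplingFamily.continuous_norm (h : IsDecouplingFamily μ V P L L' c κ)
    {X : Matrix (A × B) (A × B) ℂ} {Y : Matrix (A × R) (A × R) ℂ} (hX : X.IsHermitian)
    (hY : Y.IsHermitian) : Continuous fun ω =>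
      schattenNorm 1 (contract X (ampliate R (conjMap (V ω) ∘ₗ P) Y)) :=
  continuous_schattenNorm_one
    (continuous_contract _ (continuous_ampliate_conjMap h.continuous _ _))
    (h.isHermitian hX hY)

/-- One-shot decoupling with separately smoothed entropies. -/
theorem IsDecouplingFamily.lintegral_le [Nonempty A]
    (h : IsDecouplingFamily μ V P L L' c κ) {X : Matrix (A × B) (A × B) ℂ}
    {Y : Matrix (A × R) (A × R) ℂ} (hX : IsSubnormalised X) (hY : IsSubnormalised Y) {ε : ℝ}
    (hε : 0 ≤ ε) :
    ∫⁻ ω, ENNReal.ofReal (schattenNorm 1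
      (contract X (ampliate R (conjMap (V ω) ∘ₗ P) Y))) ∂μ ≤
      ENNReal.ofReal (2 * c * ε) + ENNReal.ofReal κ *
        pow2 (-((1 / 2 : ℝ) : EReal) * smoothCondEntropy ε Y -
          ((1 / 2 : ℝ) : EReal) * smoothCondEntropy ε X) := by
  refine le_add_mul_pow2 hε hY hX ENNReal.ofReal_ne_top fun α α' => ?_
  have hα := α.2.1.1.isHermitian
  have hα' := α'.2.1.1.isHermitian
  have hXh := hX.1.isHermitian
  have hYh := hY.1.isHermitian
  have hc := h.scale_nonneg
  have hnX : schattenNorm 1 X ≤ 1 := (schattenNorm_one_of_posSemidef hX.1).trans_le hX.2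
  have hnY : schattenNorm 1 Y ≤ 1 := (schattenNorm_one_of_posSemidef hY.1).trans_le hY.2
  have hnα' : schattenNorm 1 α'.1 ≤ 1 :=
    (schattenNorm_one_of_posSemidef α'.2.1.1).trans_le α'.2.1.2
  have hdX : schattenNorm 1 (α'.1 - X) ≤ ε :=
    α'.2.2.1.trans (mul_le_of_le_one_right hε hX.2)
  have hdY : schattenNorm 1 (α.1 - Y) ≤ ε :=
    α.2.2.1.trans (mul_le_of_le_one_right hε hY.2)
  set f := fun (X : Matrix (A × B) (A × B) ℂ) (Y : Matrix (A × R) (A × R) ℂ) (ω : Ω) =>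
    schattenNorm 1 (contract X (ampliate R (conjMap (V ω) ∘ₗ P) Y)) with hf
  have hm : ∀ {X Y}, X.IsHermitian → Y.IsHermitian →
      Measurable fun ω => ENNReal.ofReal (f X Y ω) := fun hX hY =>
    (h.continuous_norm hX hY).measurable.ennreal_ofReal
  -- Bilinearity: `(X, Y) = (α', α) - (α' - X, Y) - (α', α - Y)`. Each error term pairs a difference
  -- of norm at most `ε` with a matrix of norm at most one, namely `Y` or `α'`.
  have hle : ∀ ω, f X Y ω ≤ f α'.1 α.1 ω + f (α'.1 - X) Y ω + f α'.1 (α.1 - Y) ω := by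
    intro ω
    refine (le_of_eq ?_).trans (schattenNorm_one_sub_sub_le (h.isHermitian hα' hα ω)
      (h.isHermitian (hα'.sub hXh) hYh ω) (h.isHermitian hα' (hα.sub hYh) ω))
    simp only [hf, ampliate_sub, contract_sub_left, contract_sub_right]
    congr 1
    abel
  have hb1 : ∫⁻ ω, ENNReal.ofReal (f (α'.1 - X) Y ω) ∂μ ≤ ENNReal.ofReal (c * ε) := by
    refine (h.lintegral_le_first (hα'.sub hXh) hYh).trans (ENNReal.ofReal_le_ofReal ?_)
    gcongr
    exact (mul_le_mul hdX hnY (schattenNorm_one_nonneg hYh) hε).trans (mul_one ε).le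
  have hb2 : ∫⁻ ω, ENNReal.ofReal (f α'.1 (α.1 - Y) ω) ∂μ ≤ ENNReal.ofReal (c * ε) := by
    refine (h.lintegral_le_first hα' (hα.sub hYh)).trans (ENNReal.ofReal_le_ofReal ?_)
    gcongr
    exact (mul_le_mul hnα' hdY (schattenNorm_one_nonneg (hα.sub hYh)) zero_le_one).trans
      (one_mul ε).le
  calc _ ≤ ∫⁻ ω, ENNReal.ofReal (f α'.1 α.1 ω) + ENNReal.ofReal (f (α'.1 - X) Y ω) +
        ENNReal.ofReal (f α'.1 (α.1 - Y) ω) ∂μ := by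
        refine lintegral_mono fun ω => (ENNReal.ofReal_le_ofReal (hle ω)).trans ?_
        exact ENNReal.ofReal_add_le.trans (add_le_add_left ENNReal.ofReal_add_le _)
    _ = ∫⁻ ω, ENNReal.ofReal (f α'.1 α.1 ω) ∂μ + ∫⁻ ω, ENNReal.ofReal (f (α'.1 - X) Y ω) ∂μ +
        ∫⁻ ω, ENNReal.ofReal (f α'.1 (α.1 - Y) ω) ∂μ := by
        rw [lintegral_add_right _ (hm hα' (hα.sub hYh)),
          lintegral_add_right _ (hm (hα'.sub hXh) hYh)]
    _ ≤ ENNReal.ofReal (κ * (candidateNorm X α'.1 * candidateNorm Y α.1)) +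
        ENNReal.ofReal (c * ε) + ENNReal.ofReal (c * ε) := by
        gcongr
        exact h.lintegral_le_candidate hX hY α α'
    _ = _ := by
        have h1 : 0 ≤ candidateNorm Y α.1 := schattenNorm_two_nonneg _
        rw [add_assoc, ← ENNReal.ofReal_add (by positivity) (by positivity), add_comm,
          ENNReal.ofReal_mul h.factor_nonneg, ← ENNReal.ofReal_mul h1,
          mul_comm (candidateNorm X _)]
        congr 2
        ring

end Smoothed

/-! ### Traceless projections on one and on two tensor factors -/

section Depolarize

variable {m n R : Type*} [Fintype m] [DecidableEq m] [Fintype n] [DecidableEq n]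

lemma ampliate_depolarize [Fintype R] (M : Matrix (n × R) (n × R) ℂ) :
    ampliate R (depolarize n) M =
      (Fintype.card n : ℂ)⁻¹ • ((1 : Matrix n n ℂ) ⊗ₖ traceLeft M) := by
  ext p q
  rw [ampliate_apply, depolarize_apply]
  simp [traceLeft, Matrix.trace, blockSnd]
  ring

lemma IsCompletelyPositive.depolarize : IsCompletelyPositive (depolarize n) := by
  intro k M hM
  rw [ampliate_depolarize]
  exact (Matrix.PosSemidef.one.kronecker (posSemidef_traceLeft hM)).smul
    (inv_nonneg.mpr (Nat.cast_nonneg _))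

/-- The superoperator `T ⊗ 𝕀`. -/
def leftMap {m : Type*} (n : Type*) (T : Matrix m m ℂ →ₗ[ℂ] Matrix m m ℂ) :
    Matrix (m × n) (m × n) ℂ →ₗ[ℂ] Matrix (m × n) (m × n) ℂ where
  toFun := ampliate n T
  map_add' := ampliate_add T
  map_smul' r M := by
    ext p q
    have : blockSnd (r • M) p.2 q.2 = r • blockSnd M p.2 q.2 := rfl
    simp [ampliate_apply, this]

/-- The superoperator `𝕀 ⊗ T`. -/
def rightMap {n : Type*} (m : Type*) (T : Matrix n n ℂ →ₗ[ℂ] Matrix n n ℂ) :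
    Matrix (m × n) (m × n) ℂ →ₗ[ℂ] Matrix (m × n) (m × n) ℂ where
  toFun M := Matrix.of fun p q => T (blockFst M p.1 q.1) p.2 q.2
  map_add' M N := by
    ext p q
    have : blockFst (M + N) p.1 q.1 = blockFst M p.1 q.1 + blockFst N p.1 q.1 := rfl
    simp [this]
  map_smul' r M := by
    ext p q
    have : blockFst (r • M) p.1 q.1 = r • blockFst M p.1 q.1 := rfl
    simp [this]

lemma blockSnd_leftMap {m n : Type*} (T : Matrix m m ℂ →ₗ[ℂ] Matrix m m ℂ)
    (M : Matrix (m × n) (m × n) ℂ) (p q : n) :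
    blockSnd (leftMap n T M) p q = T (blockSnd M p q) := rfl

lemma blockFst_rightMap {m n : Type*} (T : Matrix n n ℂ →ₗ[ℂ] Matrix n n ℂ)
    (M : Matrix (m × n) (m × n) ℂ) (i j : m) :
    blockFst (rightMap m T M) i j = T (blockFst M i j) := rfl

/-- The other tensor factor is absorbed into the ancilla. -/
lemma IsCompletelyPositive.leftMap {m n : Type*} [Fintype n]
    {T : Matrix m m ℂ →ₗ[ℂ] Matrix m m ℂ}
    (hT : IsCompletelyPositive T) : IsCompletelyPositive (leftMap n T) := by
  intro k M hM
  exact (hT.posSemidef_ampliate (R := n × Fin k)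
    (hM.submatrix fun p : m × n × Fin k => ((p.1, p.2.1), p.2.2))).submatrix
      fun p : (m × n) × Fin k => (p.1.1, (p.1.2, p.2))

lemma IsCompletelyPositive.rightMap {m n : Type*} [Fintype m]
    {T : Matrix n n ℂ →ₗ[ℂ] Matrix n n ℂ}
    (hT : IsCompletelyPositive T) : IsCompletelyPositive (rightMap m T) := by
  intro k M hM
  exact (hT.posSemidef_ampliate (R := m × Fin k)
    (hM.submatrix fun p : n × m × Fin k => ((p.2.1, p.1), p.2.2))).submatrix
      fun p : (m × n) × Fin k => (p.1.2, (p.1.1, p.2))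

lemma trace_eq_sum_blockSnd {m n : Type*} [Fintype m] [Fintype n]
    (M : Matrix (m × n) (m × n) ℂ) : M.trace = ∑ p, (blockSnd M p p).trace := by
  simp only [Matrix.trace, Matrix.diag, Fintype.sum_prod_type, blockSnd, Matrix.of_apply]
  exact Finset.sum_comm

lemma trace_eq_sum_blockFst {m n : Type*} [Fintype m] [Fintype n]
    (M : Matrix (m × n) (m × n) ℂ) : M.trace = ∑ i, (blockFst M i i).trace := by
  simp only [Matrix.trace, Matrix.diag, Fintype.sum_prod_type, blockFst, Matrix.of_apply]

lemma trace_leftMap {m n : Type*} [Fintype m] [Fintype n]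
    {T : Matrix m m ℂ →ₗ[ℂ] Matrix m m ℂ} (hT : ∀ Z, (T Z).trace = Z.trace)
    (M : Matrix (m × n) (m × n) ℂ) : (leftMap n T M).trace = M.trace := by
  simp only [trace_eq_sum_blockSnd, blockSnd_leftMap, hT]

lemma trace_rightMap {m n : Type*} [Fintype m] [Fintype n]
    {T : Matrix n n ℂ →ₗ[ℂ] Matrix n n ℂ} (hT : ∀ Z, (T Z).trace = Z.trace)
    (M : Matrix (m × n) (m × n) ℂ) : (rightMap m T M).trace = M.trace := by
  simp only [trace_eq_sum_blockFst, blockFst_rightMap, hT]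

/-- The projection onto the part that is traceless on both factors. -/
def centerPair (m n : Type*) [Fintype m] [DecidableEq m] [Fintype n] [DecidableEq n] :
    Matrix (m × n) (m × n) ℂ →ₗ[ℂ] Matrix (m × n) (m × n) ℂ :=
  leftMap n (center m) ∘ₗ rightMap m (center n)

lemma leftMap_center {n : Type*} : leftMap n (center m) = LinearMap.id - leftMap n (depolarize m) := rfl

lemma rightMap_center {m : Type*} : rightMap m (center n) = LinearMap.id - rightMap m (depolarize n) := rfl

/-- Expands `(id - D₁)(id - D₂)` by sign, `D_i` being the depolarising maps. All four maps preserve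
the trace, which is the source of the scale 4. -/
lemma centerPair_eq : centerPair m n =
    (LinearMap.id + leftMap n (depolarize m) ∘ₗ rightMap m (depolarize n)) -
      (leftMap n (depolarize m) + rightMap m (depolarize n)) := by
  rw [centerPair, leftMap_center, rightMap_center]
  ext1 Z
  simp only [LinearMap.comp_apply, LinearMap.sub_apply, LinearMap.add_apply, LinearMap.id_apply,
    map_sub]
  abel

lemma trace_blockSnd_centerPair [Nonempty m] (M : Matrix (m × n) (m × n) ℂ) (p q : n) :
    (blockSnd (centerPair m n M) p q).trace = 0 := by
  rw [centerPair, LinearMap.comp_apply, blockSnd_leftMap, trace_center]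

/-- The inner map makes the partial trace over `n` vanish, and the outer one, acting on `m` only,
commutes with that partial trace. -/
lemma trace_blockFst_centerPair [Nonempty n] (M : Matrix (m × n) (m × n) ℂ) (i j : m) :
    (blockFst (centerPair m n M) i j).trace = 0 := by
  have h : ∀ (N : Matrix (m × n) (m × n) ℂ) i j,
      (blockFst N i j).trace = (∑ p, blockSnd N p p) i j := by
    intro N i j
    rw [Matrix.sum_apply]
    rfl
  have h0 : ∑ p, blockSnd (rightMap m (center n) M) p p = 0 := by
    ext i j
    rw [← h, blockFst_rightMap, trace_center]
    rfl
  rw [h, centerPair, LinearMap.comp_apply]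
  simp only [blockSnd_leftMap, ← map_sum, h0, map_zero]
  rfl

lemma frobSq_centerPair_le [Nonempty m] [Nonempty n] (M : Matrix (m × n) (m × n) ℂ) :
    frobSq (centerPair m n M) ≤ frobSq M := by
  refine le_trans ?_ (frobSq_centerBlocks_le M)
  change frobSq (leftMap n (center m) (centerBlocks M)) ≤ _
  rw [← sum_frobSq_blockSnd, ← sum_frobSq_blockSnd (centerBlocks M)]
  gcongr with p _ q _
  rw [blockSnd_leftMap]
  exact frobSq_center_le _

end Depolarize

/-! ### The Haar families on one and on two factors -/

section Families

variable {m n : Type*} [Fintype m] [DecidableEq m] [Fintype n] [DecidableEq n]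

lemma dimFactor_nonneg {n : Type*} [Fintype n] [Nontrivial n] : 0 ≤ dimFactor n := by
  refine Real.rpow_nonneg ?_ _
  have := one_lt_card_real (n := n)
  rw [sub_nonneg]
  exact inv_le_one_of_one_le₀ (by nlinarith)

lemma sq_dimFactor_div_card {n : Type*} [Fintype n] [Nontrivial n] :
    (dimFactor n / Fintype.card n) ^ 2 = ((Fintype.card n : ℝ) ^ 2 - 1)⁻¹ := by
  have h1 := one_lt_card_real (n := n)
  have h2 := card_sq_sub_one_pos (n := n)
  have h3 : (0 : ℝ) ≤ 1 - ((Fintype.card n : ℝ) ^ 2)⁻¹ := by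
    rw [sub_nonneg]
    exact inv_le_one_of_one_le₀ (by nlinarith)
  rw [div_pow, dimFactor, ← Real.rpow_natCast, ← Real.rpow_mul h3]
  norm_num
  rw [Real.rpow_neg_one]
  have h4 : (Fintype.card n : ℝ) ≠ 0 := by positivity
  have h5 : 1 - ((Fintype.card n : ℝ) ^ 2)⁻¹ ≠ 0 := by
    have : 1 - ((Fintype.card n : ℝ) ^ 2)⁻¹ =
        ((Fintype.card n : ℝ) ^ 2 - 1) / (Fintype.card n : ℝ) ^ 2 := by field_simp
    rw [this]
    positivity
  have h6 := h2.ne'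
  field_simp

/-- Used with the coordinate projections, to view the single-unitary families on the product
probability space. -/
lemma IsDecouplingFamily.comp_measurePreserving {Ω Ω' : Type*} [TopologicalSpace Ω]
    [MeasurableSpace Ω] [OpensMeasurableSpace Ω] [TopologicalSpace Ω'] [MeasurableSpace Ω']
    {μ : Measure Ω} {μ' : Measure Ω'} {V : Ω → Matrix n n ℂ}
    {P L L' : Matrix n n ℂ →ₗ[ℂ] Matrix n n ℂ} {c κ : ℝ}
    (h : IsDecouplingFamily μ V P L L' c κ) {g : Ω' → Ω} (hg : Continuous g)
    (hg' : MeasurePreserving g μ' μ) : IsDecouplingFamily μ' (V ∘ g) P L L' c κ where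
  continuous := h.continuous.comp hg
  twirl Z i j := by
    rw [← h.twirl Z i j, ← hg'.map_eq, integral_map hg'.measurable.aemeasurable
      (continuous_conj_entry h.continuous Z i j).measurable.aestronglyMeasurable]
    rfl
  second_moment X Y := by
    refine le_of_eq_of_le ?_ (h.second_moment X Y)
    rw [← hg'.map_eq, integral_map hg'.measurable.aemeasurable
      (continuous_sq_norm_trace h.continuous X (P Y)).measurable.aestronglyMeasurable]
    rfl
  eq_sub := h.eq_sub
  cp_left := h.cp_left
  cp_right := h.cp_right
  trace_add := h.trace_add
  scale_nonneg := h.scale_nonneg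
  factor_nonneg := h.factor_nonneg

lemma isDecouplingFamily_unitaryHaar [Nontrivial n] :
    IsDecouplingFamily (unitaryHaar n) (fun U => (U : Matrix n n ℂ)) (center n) LinearMap.id
      (depolarize n) 2 (dimFactor n) where
  continuous := continuous_subtype_val
  twirl Z i j := integral_conj_apply Z i j
  second_moment X Y := by
    rw [sq_dimFactor_div_card]
    refine (integral_sq_norm_trace_le X _ (trace_center Y)).trans ?_
    have := card_sq_sub_one_pos (n := n)
    have := frobSq_center_le Y
    have := frobSq_nonneg X
    gcongr
  eq_sub := rfl
  cp_left := IsCompletelyPositive.id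
  cp_right := IsCompletelyPositive.depolarize
  trace_add Z := by
    rw [LinearMap.add_apply, Matrix.trace_add, trace_depolarize, LinearMap.id_apply]
    push_cast
    ring
  scale_nonneg := by norm_num
  factor_nonneg := dimFactor_nonneg

/-- Averaging over the second unitary replaces that factor by its partial trace times a maximally
mixed state; the first average then acts on the marginal. -/
lemma integral_conj_kronecker_apply [Nontrivial m] [Nontrivial n]
    (Z : Matrix (m × n) (m × n) ℂ) (s t : m × n) :
    ∫ U, (((U.1 : Matrix m m ℂ) ⊗ₖ (U.2 : Matrix n n ℂ)) * Z *
        ((U.1 : Matrix m m ℂ) ⊗ₖ (U.2 : Matrix n n ℂ))ᴴ) s t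
        ∂((unitaryHaar m).prod (unitaryHaar n)) =
      if s = t then Z.trace / Fintype.card (m × n) else 0 := by
  have hc : Continuous fun U : Matrix.unitaryGroup m ℂ × Matrix.unitaryGroup n ℂ =>
      (U.1 : Matrix m m ℂ) ⊗ₖ (U.2 : Matrix n n ℂ) :=
    continuous_kronecker (continuous_subtype_val.comp continuous_fst)
      (continuous_subtype_val.comp continuous_snd)
  rw [integral_prod _ (integrable_of_continuous _ (continuous_conj_entry hc Z s t))]
  have h1 : ∀ (U : Matrix.unitaryGroup m ℂ) (W : Matrix.unitaryGroup n ℂ),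
      (((U : Matrix m m ℂ) ⊗ₖ (W : Matrix n n ℂ)) * Z *
        ((U : Matrix m m ℂ) ⊗ₖ (W : Matrix n n ℂ))ᴴ) s t =
      ((W : Matrix n n ℂ) * blockFst (((U : Matrix m m ℂ) ⊗ₖ (1 : Matrix n n ℂ)) * Z *
        ((U : Matrix m m ℂ) ⊗ₖ (1 : Matrix n n ℂ))ᴴ) s.1 t.1 * (W : Matrix n n ℂ)ᴴ) s.2 t.2 := by
    intro U W
    rw [← blockFst_kronecker_mul]
    have : (U : Matrix m m ℂ) ⊗ₖ (W : Matrix n n ℂ) =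
        ((1 : Matrix m m ℂ) ⊗ₖ (W : Matrix n n ℂ)) *
          ((U : Matrix m m ℂ) ⊗ₖ (1 : Matrix n n ℂ)) := by
      rw [← Matrix.mul_kronecker_mul, one_mul, mul_one]
    rw [this, Matrix.conjTranspose_mul]
    simp only [mul_assoc]
    rfl
  have h2 : ∀ U : Matrix.unitaryGroup m ℂ,
      (blockFst (((U : Matrix m m ℂ) ⊗ₖ (1 : Matrix n n ℂ)) * Z *
        ((U : Matrix m m ℂ) ⊗ₖ (1 : Matrix n n ℂ))ᴴ) s.1 t.1).trace =
      ((U : Matrix m m ℂ) * traceRight Z * (U : Matrix m m ℂ)ᴴ) s.1 t.1 := by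
    intro U
    simp only [traceRight, Finset.mul_sum, Finset.sum_mul, ← blockSnd_kronecker_mul,
      Matrix.sum_apply]
    rfl
  simp only [h1, integral_conj_apply, h2]
  by_cases hp : s.2 = t.2
  · simp only [hp, if_true, integral_div, integral_conj_apply, trace_traceRight, Prod.ext_iff,
      and_true, ite_div, zero_div, div_div, Fintype.card_prod, Nat.cast_mul]
  · simp [hp, Prod.ext_iff]

lemma isDecouplingFamily_unitaryHaar_prod [Nontrivial m] [Nontrivial n] :
    IsDecouplingFamily ((unitaryHaar m).prod (unitaryHaar n))
      (fun U => (U.1 : Matrix m m ℂ) ⊗ₖ (U.2 : Matrix n n ℂ)) (centerPair m n)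
      (LinearMap.id + leftMap n (depolarize m) ∘ₗ rightMap m (depolarize n))
      (leftMap n (depolarize m) + rightMap m (depolarize n)) 4 (dimFactor m * dimFactor n) where
  continuous := continuous_kronecker (continuous_subtype_val.comp continuous_fst)
      (continuous_subtype_val.comp continuous_snd)
  twirl Z i j := integral_conj_kronecker_apply Z i j
  second_moment X Y := by
    rw [Fintype.card_prod, Nat.cast_mul, mul_div_mul_comm, mul_pow, sq_dimFactor_div_card,
      sq_dimFactor_div_card]
    refine (integral_sq_norm_trace_kronecker_le X _ (trace_blockSnd_centerPair Y)
      (trace_blockFst_centerPair Y)).trans ?_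
    have := card_sq_sub_one_pos (n := n)
    have := card_sq_sub_one_pos (n := m)
    have := frobSq_centerPair_le Y
    have := frobSq_nonneg X
    gcongr
  eq_sub := centerPair_eq
  cp_left := IsCompletelyPositive.id.add
    (IsCompletelyPositive.depolarize.leftMap.comp IsCompletelyPositive.depolarize.rightMap)
  cp_right := IsCompletelyPositive.depolarize.leftMap.add
    IsCompletelyPositive.depolarize.rightMap
  trace_add Z := by
    simp only [LinearMap.add_apply, LinearMap.comp_apply, LinearMap.id_apply, Matrix.trace_add,
      trace_leftMap trace_depolarize, trace_rightMap trace_depolarize]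
    push_cast
    ring
  scale_nonneg := by norm_num
  factor_nonneg := mul_nonneg dimFactor_nonneg dimFactor_nonneg

end Families

/-! ### The Choi state represents the superoperator -/

section Choi

variable {A₁ A₂ B R : Type*} [Fintype A₁] [DecidableEq A₁] [Fintype A₂] [DecidableEq A₂]

lemma choiState_apply [Nonempty A₁] [Nonempty A₂]
    (T : Matrix (A₁ × A₂) (A₁ × A₂) ℂ →ₗ[ℂ] Matrix B B ℂ) (p q : (A₁ × A₂) × B) :
    choiState T p q =
      (Fintype.card (A₁ × A₂) : ℂ)⁻¹ * T (Matrix.single p.1 q.1 1) p.2 q.2 := by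
  have h : (Matrix.of fun a a' => eprPair A₁ A₂ (a, p.1) (a', q.1)) =
      (Fintype.card (A₁ × A₂) : ℂ)⁻¹ • Matrix.single p.1 q.1 1 := by
    ext a a'
    simp [eprPair, epr, Matrix.single_apply, Prod.ext_iff]
    split_ifs <;> simp_all [mul_comm]
  change T (Matrix.of fun a a' => eprPair A₁ A₂ (a, p.1) (a', q.1)) p.2 q.2 = _
  rw [h, map_smul]
  rfl

/-- The Choi state stores `|A|⁻¹ T(|a⟩⟨a'|)` in its blocks, and `M` is expanded in matrix units; the
factor `|A|` in `contract` cancels the normalisation. -/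
lemma ampliate_eq_contract_choiState [Nonempty A₁] [Nonempty A₂]
    (T : Matrix (A₁ × A₂) (A₁ × A₂) ℂ →ₗ[ℂ] Matrix B B ℂ)
    (M : Matrix ((A₁ × A₂) × R) ((A₁ × A₂) × R) ℂ) :
    ampliate R T M = contract (choiState T) M := by
  ext p q
  have hd : (Fintype.card (A₁ × A₂) : ℂ) ≠ 0 := by
    exact_mod_cast Fintype.card_ne_zero
  have h : blockSnd M p.2 q.2 =
      ∑ a, ∑ a', M (a, p.2) (a', q.2) • Matrix.single a a' (1 : ℂ) := by
    conv_lhs => rw [Matrix.matrix_eq_sum_single (blockSnd M p.2 q.2)]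
    simp [blockSnd]
  rw [ampliate_apply, contract_apply, h]
  simp only [map_sum, map_smul, Matrix.sum_apply, Matrix.smul_apply, smul_eq_mul, choiState_apply,
    Finset.mul_sum]
  refine Finset.sum_congr rfl fun a _ => Finset.sum_congr rfl fun a' _ => ?_
  field_simp

lemma posSemidef_epr {A : Type*} [Fintype A] [DecidableEq A] : (epr A).PosSemidef := by
  have h : epr A = (Fintype.card A : ℂ)⁻¹ •
      Matrix.vecMulVec (fun p : A × A => if p.1 = p.2 then (1 : ℂ) else 0)
        (star fun p : A × A => if p.1 = p.2 then (1 : ℂ) else 0) := by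
    ext p q
    simp [epr, Matrix.vecMulVec_apply, apply_ite (starRingEnd ℂ), ite_and]
    split_ifs <;> rfl
  rw [h]
  exact (Matrix.posSemidef_vecMulVec_self_star _).smul (inv_nonneg.mpr (Nat.cast_nonneg _))

lemma isSubnormalised_choiState [Fintype B] [Nonempty A₁] [Nonempty A₂]
    {T : Matrix (A₁ × A₂) (A₁ × A₂) ℂ →ₗ[ℂ] Matrix B B ℂ}
    (hT : IsCompletelyPositive T) (hT' : IsTraceNonincreasing T) :
    IsSubnormalised (choiState T) := by
  have hd : (Fintype.card (A₁ × A₂) : ℂ) ≠ 0 := by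
    exact_mod_cast Fintype.card_ne_zero
  refine ⟨(hT.posSemidef_ampliate
    ((posSemidef_epr.kronecker posSemidef_epr).submatrix _)).submatrix _, ?_⟩
  have hpos : ((Fintype.card (A₁ × A₂) : ℂ)⁻¹ •
      (1 : Matrix (A₁ × A₂) (A₁ × A₂) ℂ)).PosSemidef :=
    Matrix.PosSemidef.one.smul (inv_nonneg.mpr (Nat.cast_nonneg _))
  have h := hT' _ hpos
  -- Tracing out the reference copy of the EPR state leaves the maximally mixed input.
  have e : (choiState T).trace =
      (T ((Fintype.card (A₁ × A₂) : ℂ)⁻¹ • (1 : Matrix (A₁ × A₂) (A₁ × A₂) ℂ))).trace := by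
    have h1 : (1 : Matrix (A₁ × A₂) (A₁ × A₂) ℂ) = ∑ a, Matrix.single a a 1 :=
      (Matrix.sum_single_one).symm
    rw [map_smul, h1, map_sum, Matrix.trace_smul, Matrix.trace_sum]
    simp only [Matrix.trace, Matrix.diag, choiState_apply, Fintype.sum_prod_type (α₁ := A₁ × A₂),
      Finset.mul_sum, smul_eq_mul]
  rw [e]
  refine h.trans (le_of_eq ?_)
  rw [Matrix.trace_smul, Matrix.trace_one, smul_eq_mul, inv_mul_cancel₀ hd, Complex.one_re]

end Choi

/-! ### Marginals of subnormalised states -/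

section Marginals

variable {X Y Z : Type*} [Fintype X] [Fintype Y] [Fintype Z]

lemma isSubnormalised_marginalFst {M : Matrix ((X × Y) × Z) ((X × Y) × Z) ℂ}
    (hM : IsSubnormalised M) : IsSubnormalised (marginalFst M) := by
  constructor
  · have : marginalFst M = ∑ y, M.submatrix (fun p : X × Z => ((p.1, y), p.2))
        (fun p : X × Z => ((p.1, y), p.2)) := by
      ext p q
      simp [marginalFst, Matrix.sum_apply]
    rw [this]
    exact Matrix.posSemidef_sum _ fun y _ => hM.1.submatrix _
  · refine le_of_eq_of_le (congrArg Complex.re ?_) hM.2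
    simp only [Matrix.trace, Matrix.diag, marginalFst, Matrix.of_apply, Fintype.sum_prod_type]
    exact Finset.sum_congr rfl fun x _ => Finset.sum_comm

lemma isSubnormalised_marginalSnd {M : Matrix ((X × Y) × Z) ((X × Y) × Z) ℂ}
    (hM : IsSubnormalised M) : IsSubnormalised (marginalSnd M) := by
  constructor
  · have : marginalSnd M = ∑ x, M.submatrix (fun p : Y × Z => ((x, p.1), p.2))
        (fun p : Y × Z => ((x, p.1), p.2)) := by
      ext p q
      simp [marginalSnd, Matrix.sum_apply]
    rw [this]
    exact Matrix.posSemidef_sum _ fun y _ => hM.1.submatrix _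
  · refine le_of_eq_of_le (congrArg Complex.re ?_) hM.2
    simp only [Matrix.trace, Matrix.diag, marginalSnd, Matrix.of_apply, Fintype.sum_prod_type]
    exact (Finset.sum_congr rfl fun y _ => Finset.sum_comm).trans Finset.sum_comm

end Marginals

/-! ### Splitting the perturbed state into four terms -/

section Decomposition

variable {m n B R : Type*} [Fintype m] [DecidableEq m] [Fintype n] [DecidableEq n]

/-- The superoperator `Z ↦ S(Z^m) ⊗ |n|⁻¹ 1`. -/
def leftPart (S : Matrix m m ℂ →ₗ[ℂ] Matrix m m ℂ) (Z : Matrix (m × n) (m × n) ℂ) :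
    Matrix (m × n) (m × n) ℂ :=
  (Fintype.card n : ℂ)⁻¹ • (S (traceRight Z) ⊗ₖ (1 : Matrix n n ℂ))

/-- The superoperator `Z ↦ |m|⁻¹ 1 ⊗ S(Z^n)`. -/
def rightPart (S : Matrix n n ℂ →ₗ[ℂ] Matrix n n ℂ) (Z : Matrix (m × n) (m × n) ℂ) :
    Matrix (m × n) (m × n) ℂ :=
  (Fintype.card m : ℂ)⁻¹ • ((1 : Matrix m m ℂ) ⊗ₖ S (traceLeft Z))

/-- Expansion of `(C₁ + D₁)(C₂ + D₂)` with `C_i` the traceless projections: `leftPart` is `C₁D₂`,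
`rightPart` is `D₁C₂`, and the last summand is `D₁D₂`. -/
lemma eq_centerPair_add (Z : Matrix (m × n) (m × n) ℂ) :
    Z = centerPair m n Z + leftPart (center m) Z + rightPart (center n) Z +
      ((Fintype.card (m × n) : ℂ)⁻¹ * Z.trace) • (1 : Matrix (m × n) (m × n) ℂ) := by
  have hL : ∀ Z : Matrix (m × n) (m × n) ℂ, leftMap n (depolarize m) Z =
      (Fintype.card m : ℂ)⁻¹ • ((1 : Matrix m m ℂ) ⊗ₖ traceLeft Z) := ampliate_depolarize
  have hR : ∀ Z : Matrix (m × n) (m × n) ℂ, rightMap m (depolarize n) Z =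
      (Fintype.card n : ℂ)⁻¹ • (traceRight Z ⊗ₖ (1 : Matrix n n ℂ)) := by
    intro Z
    ext p q
    change depolarize n (blockFst Z p.1 q.1) p.2 q.2 = _
    rw [depolarize_apply]
    simp only [traceRight, Matrix.trace, blockFst, blockSnd, Matrix.smul_apply, smul_eq_mul,
      Matrix.kroneckerMap_apply, Matrix.sum_apply, Matrix.of_apply, Matrix.diag]
    ring
  have hLR : leftMap n (depolarize m) (rightMap m (depolarize n) Z) =
      ((Fintype.card (m × n) : ℂ)⁻¹ * Z.trace) • (1 : Matrix (m × n) (m × n) ℂ) := by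
    have : traceLeft (traceRight Z ⊗ₖ (1 : Matrix n n ℂ)) = Z.trace • (1 : Matrix n n ℂ) := by
      rw [← trace_traceRight]
      ext p q
      simp [traceLeft, Matrix.trace, Matrix.one_apply]
    have h' : traceLeft ((Fintype.card n : ℂ)⁻¹ • (traceRight Z ⊗ₖ (1 : Matrix n n ℂ))) =
        (Fintype.card n : ℂ)⁻¹ • (Z.trace • (1 : Matrix n n ℂ)) := by
      rw [← this]
      ext p q
      simp [traceLeft, Finset.mul_sum]
    rw [hL, hR, h', Matrix.kronecker_smul, Matrix.kronecker_smul, Matrix.one_kronecker_one,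
      smul_smul, smul_smul, Fintype.card_prod, Nat.cast_mul, mul_inv]
  have hs₁ : ∀ (M M' : Matrix m m ℂ) (N : Matrix n n ℂ), (M - M') ⊗ₖ N = M ⊗ₖ N - M' ⊗ₖ N := by
    intro M M' N
    ext p q
    simp [sub_mul]
  have hs₂ : ∀ (M : Matrix m m ℂ) (N N' : Matrix n n ℂ), M ⊗ₖ (N - N') = M ⊗ₖ N - M ⊗ₖ N' := by
    intro M N N'
    ext p q
    simp [mul_sub]
  have hl : leftPart (n := n) (center m) Z = rightMap m (depolarize n) Z -
      ((Fintype.card (m × n) : ℂ)⁻¹ * Z.trace) • (1 : Matrix (m × n) (m × n) ℂ) := by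
    rw [hR, leftPart, center, LinearMap.sub_apply, LinearMap.id_apply, depolarize_apply,
      trace_traceRight, hs₁, Matrix.smul_kronecker, Matrix.one_kronecker_one,
      smul_sub, smul_smul, Fintype.card_prod, Nat.cast_mul, mul_inv]
    ring_nf
  have hr : rightPart (m := m) (center n) Z = leftMap n (depolarize m) Z -
      ((Fintype.card (m × n) : ℂ)⁻¹ * Z.trace) • (1 : Matrix (m × n) (m × n) ℂ) := by
    rw [hL, rightPart, center, LinearMap.sub_apply, LinearMap.id_apply, depolarize_apply,
      trace_traceLeft, hs₂, Matrix.kronecker_smul, Matrix.one_kronecker_one,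
      smul_sub, smul_smul, Fintype.card_prod, Nat.cast_mul, mul_inv]
    ring_nf
  rw [hl, hr, centerPair_eq]
  simp only [LinearMap.sub_apply, LinearMap.add_apply, LinearMap.comp_apply, LinearMap.id_apply,
    hLR]
  abel

/-- The identity on `n` traces that factor out of `τ`, and its weight `|n|⁻¹` turns the prefactor
`|m||n|` into the `|m|` appropriate to the marginals. -/
lemma contract_leftPart {m : Type*} [Fintype m] [Nonempty n] (S : Matrix m m ℂ →ₗ[ℂ] Matrix m m ℂ)
    (τ : Matrix ((m × n) × B) ((m × n) × B) ℂ) (ρ : Matrix ((m × n) × R) ((m × n) × R) ℂ) :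
    contract τ (Matrix.of fun p q => leftPart S (blockSnd ρ p.2 q.2) p.1 q.1) =
      contract (marginalFst τ) (ampliate R S (marginalFst ρ)) := by
  have hd : (Fintype.card n : ℂ) ≠ 0 := by simp
  have hb : ∀ r s, blockSnd (marginalFst ρ) r s = traceRight (blockSnd ρ r s) := by
    intro r s
    ext i j
    simp [traceRight, Matrix.sum_apply, blockSnd, marginalFst]
  ext p q
  simp only [contract_apply, ampliate_apply, hb]
  simp only [Matrix.of_apply, leftPart, Matrix.smul_apply,
    Matrix.kroneckerMap_apply, smul_eq_mul, Fintype.sum_prod_type, Matrix.one_apply, mul_ite,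
    mul_one, mul_zero, Finset.sum_ite_eq, Finset.mem_univ, if_true, marginalFst,
    Fintype.card_prod, Nat.cast_mul, Finset.mul_sum, Finset.sum_mul]
  refine Finset.sum_congr rfl fun i _ => ?_
  rw [Finset.sum_comm]
  refine Finset.sum_congr rfl fun j _ => Finset.sum_congr rfl fun y _ => ?_
  field_simp

lemma contract_rightPart {n : Type*} [Fintype n] [Nonempty m] (S : Matrix n n ℂ →ₗ[ℂ] Matrix n n ℂ)
    (τ : Matrix ((m × n) × B) ((m × n) × B) ℂ) (ρ : Matrix ((m × n) × R) ((m × n) × R) ℂ) :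
    contract τ (Matrix.of fun p q => rightPart S (blockSnd ρ p.2 q.2) p.1 q.1) =
      contract (marginalSnd τ) (ampliate R S (marginalSnd ρ)) := by
  have hd : (Fintype.card m : ℂ) ≠ 0 := by simp
  have hb : ∀ r s, blockSnd (marginalSnd ρ) r s = traceLeft (blockSnd ρ r s) := by
    intro r s
    ext i j
    simp [traceLeft, blockSnd, marginalSnd]
  ext p q
  simp only [contract_apply, ampliate_apply, hb]
  simp only [Matrix.of_apply, rightPart, Matrix.smul_apply, Matrix.kroneckerMap_apply,
    smul_eq_mul, Fintype.sum_prod_type, Fintype.card_prod, Nat.cast_mul, marginalSnd]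
  have h : ∀ i y, ∑ j, ∑ z, τ ((i, y), p.1) ((j, z), q.1) * ((Fintype.card m : ℂ)⁻¹ *
      ((1 : Matrix m m ℂ) i j * S (traceLeft (blockSnd ρ p.2 q.2)) y z)) =
      ∑ z, τ ((i, y), p.1) ((i, z), q.1) * ((Fintype.card m : ℂ)⁻¹ *
        S (traceLeft (blockSnd ρ p.2 q.2)) y z) := fun i y =>
    (Fintype.sum_eq_single i fun j hj => by simp [Matrix.one_apply_ne hj.symm]).trans (by simp)
  simp only [h, Finset.sum_mul, Finset.mul_sum]
  rw [Finset.sum_comm]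
  refine Finset.sum_congr rfl fun y _ => ?_
  rw [Finset.sum_comm]
  refine Finset.sum_congr rfl fun z _ => Finset.sum_congr rfl fun i _ => ?_
  field_simp

lemma contract_scalar [Nonempty m] [Nonempty n]
    (τ : Matrix ((m × n) × B) ((m × n) × B) ℂ) (ρ : Matrix ((m × n) × R) ((m × n) × R) ℂ) :
    contract τ (Matrix.of fun p q => (((Fintype.card (m × n) : ℂ)⁻¹ *
      (blockSnd ρ p.2 q.2).trace) • (1 : Matrix (m × n) (m × n) ℂ)) p.1 q.1) =
      traceLeft τ ⊗ₖ traceLeft ρ := by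
  have hd : (Fintype.card (m × n) : ℂ) ≠ 0 := by
    exact_mod_cast Fintype.card_ne_zero
  ext p q
  have ht : (blockSnd ρ p.2 q.2).trace = traceLeft ρ p.2 q.2 := rfl
  simp only [contract_apply, Matrix.of_apply, Matrix.smul_apply, smul_eq_mul, Matrix.one_apply,
    mul_ite, mul_one, mul_zero, Finset.sum_ite_eq, Finset.mem_univ, if_true, ht,
    Matrix.kroneckerMap_apply, ← Finset.sum_mul]
  rw [show traceLeft τ p.1 q.1 = ∑ a, τ (a, p.1) (a, q.1) from rfl]
  field_simp

lemma conjMap_kronecker (U : Matrix.unitaryGroup m ℂ) (W : Matrix.unitaryGroup n ℂ)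
    (M : Matrix m m ℂ) (N : Matrix n n ℂ) :
    conjMap ((U : Matrix m m ℂ) ⊗ₖ (W : Matrix n n ℂ)) (M ⊗ₖ N) =
      conjMap (U : Matrix m m ℂ) M ⊗ₖ conjMap (W : Matrix n n ℂ) N := by
  simp only [conjMap_apply, Matrix.conjTranspose_kronecker, ← Matrix.mul_kronecker_mul]

lemma conjMap_one (U : Matrix.unitaryGroup m ℂ) : conjMap (U : Matrix m m ℂ) 1 = 1 := by
  rw [conjMap_apply, mul_one]
  exact Matrix.mem_unitaryGroup_iff.mp U.2

/-- Conjugation by a unitary fixes the identity, so each mixed term retains only the unitary on its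
traceless factor and the constant term retains neither. -/
lemma contract_conjMap_eq [Nonempty m] [Nonempty n] [Fintype R]
    (τ : Matrix ((m × n) × B) ((m × n) × B) ℂ) (ρ : Matrix ((m × n) × R) ((m × n) × R) ℂ)
    (U : Matrix.unitaryGroup m ℂ) (W : Matrix.unitaryGroup n ℂ) :
    contract τ (ampliate R (conjMap ((U : Matrix m m ℂ) ⊗ₖ (W : Matrix n n ℂ))) ρ) =
      contract (marginalFst τ)
        (ampliate R (conjMap (U : Matrix m m ℂ) ∘ₗ center m) (marginalFst ρ)) +
      contract (marginalSnd τ)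
        (ampliate R (conjMap (W : Matrix n n ℂ) ∘ₗ center n) (marginalSnd ρ)) +
      contract τ (ampliate R (conjMap ((U : Matrix m m ℂ) ⊗ₖ (W : Matrix n n ℂ)) ∘ₗ
        centerPair m n) ρ) + traceLeft τ ⊗ₖ traceLeft ρ := by
  rw [← contract_leftPart, ← contract_rightPart, ← contract_scalar, ← contract_add_right,
    ← contract_add_right, ← contract_add_right]
  congr 1
  ext p q
  simp only [Matrix.add_apply, Matrix.of_apply, ampliate_apply, LinearMap.comp_apply]
  conv_lhs => rw [eq_centerPair_add (blockSnd ρ p.2 q.2)]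
  simp only [map_add, map_smul, leftPart, rightPart, conjMap_kronecker, conjMap_one]
  rw [← Matrix.one_kronecker_one, conjMap_kronecker, conjMap_one, conjMap_one]
  simp only [Matrix.add_apply, LinearMap.comp_apply]
  ring

end Decomposition

/-! ### Assembling the bound -/

section Final

variable {A₁ A₂ B R : Type*} [Fintype A₁] [DecidableEq A₁] [Fintype A₂] [DecidableEq A₂]
  [Fintype B] [DecidableEq B] [Fintype R] [DecidableEq R]

lemma perturbedState_sub_eq {B : Type*} [Nonempty A₁] [Nonempty A₂]
    (T : Matrix (A₁ × A₂) (A₁ × A₂) ℂ →ₗ[ℂ] Matrix B B ℂ)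
    (ρ : Matrix ((A₁ × A₂) × R) ((A₁ × A₂) × R) ℂ)
    (U : Matrix.unitaryGroup A₁ ℂ) (W : Matrix.unitaryGroup A₂ ℂ) :
    perturbedState T ρ U.1 W.1 - traceLeft (choiState T) ⊗ₖ traceLeft ρ =
      contract (marginalFst (choiState T))
        (ampliate R (conjMap (U : Matrix A₁ A₁ ℂ) ∘ₗ center A₁) (marginalFst ρ)) +
      contract (marginalSnd (choiState T))
        (ampliate R (conjMap (W : Matrix A₂ A₂ ℂ) ∘ₗ center A₂) (marginalSnd ρ)) +
      contract (choiState T)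
        (ampliate R (conjMap ((U : Matrix A₁ A₁ ℂ) ⊗ₖ (W : Matrix A₂ A₂ ℂ)) ∘ₗ
          centerPair A₁ A₂) ρ) := by
  rw [perturbedState, ← ampliate_conjMap, ampliate_eq_contract_choiState, contract_conjMap_eq,
    add_sub_cancel_right]

/-- Bipartite decoupling with independently smoothed entropies and the constants `1`. -/
theorem lintegral_perturbedState_le [Nontrivial A₁] [Nontrivial A₂]
    {T : Matrix (A₁ × A₂) (A₁ × A₂) ℂ →ₗ[ℂ] Matrix B B ℂ}
    (hT : IsCompletelyPositive T) (hT' : IsTraceNonincreasing T)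
    {ρ : Matrix ((A₁ × A₂) × R) ((A₁ × A₂) × R) ℂ} (hρ : IsSubnormalised ρ)
    {ε : ℝ} (hε : 0 ≤ ε) :
    ∫⁻ U, ENNReal.ofReal (schattenNorm 1
        (perturbedState T ρ U.1.1 U.2.1 - traceLeft (choiState T) ⊗ₖ traceLeft ρ))
        ∂((unitaryHaar A₁).prod (unitaryHaar A₂))
      ≤ ENNReal.ofReal (16 * ε)
        + ENNReal.ofReal (dimFactor A₁) *
          pow2 (-((1 / 2 : ℝ) : EReal) * smoothCondEntropy ε (marginalFst ρ)
            - ((1 / 2 : ℝ) : EReal) * smoothCondEntropy ε (marginalFst (choiState T)))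
        + ENNReal.ofReal (dimFactor A₂) *
          pow2 (-((1 / 2 : ℝ) : EReal) * smoothCondEntropy ε (marginalSnd ρ)
            - ((1 / 2 : ℝ) : EReal) * smoothCondEntropy ε (marginalSnd (choiState T)))
        + ENNReal.ofReal (dimFactor A₁ * dimFactor A₂) *
          pow2 (-((1 / 2 : ℝ) : EReal) * smoothCondEntropy ε ρ
            - ((1 / 2 : ℝ) : EReal) * smoothCondEntropy ε (choiState T)) := by
  have h₁ := (isDecouplingFamily_unitaryHaar (n := A₁)).comp_measurePreserving continuous_fst
    (measurePreserving_fst (μ := unitaryHaar A₁) (ν := unitaryHaar A₂))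
  have h₂ := (isDecouplingFamily_unitaryHaar (n := A₂)).comp_measurePreserving continuous_snd
    (measurePreserving_snd (μ := unitaryHaar A₁) (ν := unitaryHaar A₂))
  have h₁₂ := isDecouplingFamily_unitaryHaar_prod (m := A₁) (n := A₂)
  have hτ := isSubnormalised_choiState hT hT'
  have hτ₁ := isSubnormalised_marginalFst hτ
  have hτ₂ := isSubnormalised_marginalSnd hτ
  have hρ₁ := isSubnormalised_marginalFst hρ
  have hρ₂ := isSubnormalised_marginalSnd hρ
  have hH₁ := h₁.isHermitian hτ₁.1.isHermitian hρ₁.1.isHermitian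
  have hH₂ := h₂.isHermitian hτ₂.1.isHermitian hρ₂.1.isHermitian
  have hH₁₂ := h₁₂.isHermitian hτ.1.isHermitian hρ.1.isHermitian
  have hm₂ := (h₂.continuous_norm hτ₂.1.isHermitian
    hρ₂.1.isHermitian).measurable.ennreal_ofReal
  have hm₁₂ := (h₁₂.continuous_norm hτ.1.isHermitian
    hρ.1.isHermitian).measurable.ennreal_ofReal
  -- Triangle inequality over the three fluctuating terms, averaged one by one afterwards.
  have hle : ∀ U : Matrix.unitaryGroup A₁ ℂ × Matrix.unitaryGroup A₂ ℂ, _ := fun U =>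
    (schattenNorm_one_add_le ((hH₁ U).add (hH₂ U)) (hH₁₂ U)).trans
      (add_le_add_left (schattenNorm_one_add_le (hH₁ U) (hH₂ U)) _)
  simp only [perturbedState_sub_eq]
  refine (lintegral_mono fun U => (ENNReal.ofReal_le_ofReal (hle U)).trans
    (ENNReal.ofReal_add_le.trans (add_le_add_left ENNReal.ofReal_add_le _))).trans ?_
  rw [lintegral_add_right _ hm₁₂, lintegral_add_right _ hm₂]
  refine (add_le_add (add_le_add (h₁.lintegral_le hτ₁ hρ₁ hε) (h₂.lintegral_le hτ₂ hρ₂ hε))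
    (h₁₂.lintegral_le hτ hρ hε)).trans (le_of_eq ?_)
  -- Each problem contributes `2cε`, with `c = 2` for one unitary and `c = 4` for the pair.
  have e : ENNReal.ofReal (16 * ε) = ENNReal.ofReal (2 * 2 * ε) + ENNReal.ofReal (2 * 2 * ε) +
      ENNReal.ofReal (2 * 4 * ε) := by
    rw [← ENNReal.ofReal_add (by positivity) (by positivity),
      ← ENNReal.ofReal_add (by positivity) (by positivity)]
    congr 1
    ring
  rw [e]
  ring

end Final

end Decoupling
end

open Decoupling in
theorem mainTheorem4
    {A₁ A₂ B R : Type*}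
    [Fintype A₁] [DecidableEq A₁] [Fintype A₂] [DecidableEq A₂]
    [Fintype B] [DecidableEq B] [Fintype R] [DecidableEq R]
    (hA₁ : 2 ≤ Fintype.card A₁) (hA₂ : 2 ≤ Fintype.card A₂)
    (T : Matrix (A₁ × A₂) (A₁ × A₂) ℂ →ₗ[ℂ] Matrix B B ℂ)
    (hT : IsCompletelyPositive T) (hT' : IsTraceNonincreasing T)
    (ρ : Matrix ((A₁ × A₂) × R) ((A₁ × A₂) × R) ℂ) (hρ : IsSubnormalised ρ)
    (ε : ℝ) (hε : 0 < ε) (hε' : ε < 1)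
    (τ : Matrix ((A₁ × A₂) × B) ((A₁ × A₂) × B) ℂ) (hτ : τ = choiState T)
    (D₁ D₂ D₁₂ : ℝ) (hD₁ : D₁ = dimFactor A₁) (hD₂ : D₂ = dimFactor A₂)
    (hD₁₂ : D₁₂ = 2 * dimFactor A₁ * dimFactor A₂) :
    ∫⁻ U, ENNReal.ofReal (schattenNorm 1
        (perturbedState T ρ U.1.1 U.2.1 - traceLeft τ ⊗ₖ traceLeft ρ))
        ∂((unitaryHaar A₁).prod (unitaryHaar A₂))
      ≤ ENNReal.ofReal (16 * ε)
        + ENNReal.ofReal (2 * D₁) *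
          pow2 (-((1 / 2 : ℝ) : EReal) * smoothCondEntropy ε (marginalFst ρ)
            - ((1 / 2 : ℝ) : EReal) * smoothCondEntropy ε (marginalFst τ))
        + ENNReal.ofReal (2 * D₂) *
          pow2 (-((1 / 2 : ℝ) : EReal) * smoothCondEntropy ε (marginalSnd ρ)
            - ((1 / 2 : ℝ) : EReal) * smoothCondEntropy ε (marginalSnd τ))
        + ENNReal.ofReal (4 * D₁₂) *
          pow2 (-((1 / 2 : ℝ) : EReal) * smoothCondEntropy ε ρ
            - ((1 / 2 : ℝ) : EReal) * smoothCondEntropy ε τ) := by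
  have := Fintype.one_lt_card_iff_nontrivial.mp hA₁
  have := Fintype.one_lt_card_iff_nontrivial.mp hA₂
  have h₁ := dimFactor_nonneg (n := A₁)
  have h₂ := dimFactor_nonneg (n := A₂)
  have h₁₂ := mul_nonneg h₁ h₂
  subst hτ hD₁ hD₂ hD₁₂
  refine (lintegral_perturbedState_le hT hT' hρ hε.le).trans ?_
  -- The constants obtained are `D₁`, `D₂` and `D₁D₂`; they are relaxed by factors 2, 2 and 8.
  have e₁ : dimFactor A₁ ≤ 2 * dimFactor A₁ := by linarith
  have e₂ : dimFactor A₂ ≤ 2 * dimFactor A₂ := by linarith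
  have e₁₂ : dimFactor A₁ * dimFactor A₂ ≤ 4 * (2 * dimFactor A₁ * dimFactor A₂) := by linarith
  exact add_le_add (add_le_add (add_le_add le_rfl
    (mul_le_mul_left (ENNReal.ofReal_le_ofReal e₁) _))
    (mul_le_mul_left (ENNReal.ofReal_le_ofReal e₂) _))
    (mul_le_mul_left (ENNReal.ofReal_le_ofReal e₁₂) _)
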